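/- **Conventions.** "a.a." means "for all sufficiently large $n$". A function $p:\mathbb N\to\mathbb R$ is *significant* if $p(n)\ge n^{-k}$ a.a. for some $k>0$, and a nonnegative $p$ is *negligible* if $p(n)\le n^{-k}$ a.a. for every $k>0$. A *p.p.t. function* $G$ is a partial function $G(y,r)$ on pairs of bit strings, computable in polynomial time, where $r$ is a uniformly random string of $q(|y|)$ bits for some polynomial $q$. For a permutation $H$ of $\{0,1\}^n$, $\mathbb P^n\{H\circ G=I\}$ is the probability that $H(G(H(x),r))=H(x)$ for independent uniform $x\in\{0,1\}^n$ and $r$. A *weakly one-way permutation* is a polynomial-time computable $F:\{0,1\}^*\to\{0,1\}^*$ that maps $\{0,1\}^n$ bijectively to itself for every $n$, such that for some $k>0$ every p.p.t. $G$ satisfies $\mathbb P^n\{F\circ G=I\}\le 1-n^{-k}$ a.a. **Expander family.** Fix integers $c\ge1$, $e\ge 0$ and a real $\alpha<1$, and put $\beta=1-\alpha$. Let $\mathcal G_m$, $m\ge0$, be a fully explicit family of $2^e$-regular undirected graphs with vertex sets $\{0,1\}^{cm}$ (loops and parallel edges are allowed), all of whose transition matrices have second largest eigenvalue magnitude at most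 $\alpha$. Fully explicit means that there is a polynomial-time computable rotation function $R$: $R(u,j)=(v,k)$, with $u,v\in\{0,1\}^{cm}$ and $j,k\in\{0,1\}^e$, says that the $j$-th edge at $u$ is the $k$-th edge at $v$, and then $R(v,k)=(u,j)$. **Construction.** Let $F$ be a weakly one-way permutation, $t:\mathbb N\to\mathbb N$ polynomially bounded, $n=cm$ and $t=t(n)$. Let $\mathcal G'_m$ be the directed graph with an edge $(u,F(v))$ for each edge $\{u,v\}$ of $\mathcal G_m$; if $R(u,j)=(v,k)$, this edge has colours $\kappa=j$ and $\kappa'=k$. A directed $t$-walk $\mathbf x=(x_0,\dots,x_t)$ in $\mathcal G'_m$ whose $i$-th edge has colours $\kappa_i,\kappa'_i$ has the forward representation $\varphi(\mathbf x)=(x_0,\kappa_1,\dots,\kappa_t)$ and the reverse representation $\rho(\mathbf x)=(x_t,\kappa'_t,\dots,\kappa'_1)$, both in $\{0,1\}^{n+te}$. Put $F'=\rho\circ\varphi^{-1}$, a permutation of $\{0,1\}^{n+te}$. Extend $F'$ to strings of every length $N$: for the largest $m$ with $cm+t(cm)e\le N$, apply $F'$ to the first $cm+t(cm)e$ bits and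 leave the other bits unchanged (if there is no such $m$, let the extension be the identity). **Lemma.** Let $\delta=\delta(n)$ be significant and suppose that $\mathbb P^n\{F\circ G=I\}\le1-\delta(n)$ a.a. for every p.p.t. $G$. Then, with $n=cm$ and a.a. referring to $m\to\infty$ in (i) and (ii): (i) For every p.p.t. $G'$ and every significant $\varepsilon=\varepsilon(n)$, $$\mathbb P^{n+te}\{F'\circ G'=I\}\le\max\bigl((1-\beta\delta(n)/2)^{t},\ \varepsilon(n)\bigr)\quad\text{a.a.}$$ In particular, the bound $(1-\beta\delta(n)/2)^t$ itself holds a.a. whenever it is significant. (ii) If $t(n)\ge7/\beta$ a.a., then for every p.p.t. $G'$, $$\mathbb P^{n+te}\{F'\circ G'=I\}\le\max(1-2\delta(n),\,1/2)\quad\text{a.a.}$$ (iii) If $\delta(n)\ge1/2$ a.a. and $t(n)=\omega(\log n)$, then for every p.p.t. $G'$ the probability $\mathbb P^{n+te}\{F'\circ G'=I\}$ is negligible, and so is the probability $\mathbb P^{N}\{F'\circ G'=I\}$ for the extension of $F'$ to strings of every length $N$. -/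

import Mathlib

/-! ### A machine model with a running time

Data are S-expressions (binary trees).  Programs are structured while programs on S-expressions;
every operation is charged the size of the datum to which it is applied, so the size of a result
never exceeds the cost of computing it.  Polynomial time in this model is polynomial time on
Turing machines. -/

/-- S-expressions. -/
inductive SExp where
  | nil : SExp
  | cons : SExp → SExp → SExp

namespace SExp

/-- The number of nodes, leaves included. -/
def size : SExp → ℕ
  | nil => 1
  | cons a b => size a + size b + 1

/-- The left component (`nil` for `nil`). -/
def fst : SExp → SExp
  | nil => nil
  | cons a _ => a

/-- The right component (`nil` for `nil`). -/
def snd : SExp → SExp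
  | nil => nil
  | cons _ b => b

end SExp

/-- Programs; each transforms an S-expression `x`. -/
inductive Prog where
  /-- return `x` -/
  | id : Prog
  /-- return `nil` -/
  | nil : Prog
  /-- return the left component of `x` -/
  | fst : Prog
  /-- return the right component of `x` -/
  | snd : Prog
  /-- run both programs on `x` and return the pair of their results -/
  | pair : Prog → Prog → Prog
  /-- `seq f g`: run `f` on `x`, then run `g` on the result -/
  | seq : Prog → Prog → Prog
  /-- `ite c f g`: if `c` does not return `nil` on `x`, run `f` on `x`, otherwise `g` -/
  | ite : Prog → Prog → Prog → Prog
  /-- `loop c f`: while `c` does not return `nil` on `x`, replace `x` by the result of `f` -/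
  | loop : Prog → Prog → Prog

/-- `Runs p x y k`: on the datum `x`, the program `p` halts with the result `y` at cost `k`. -/
inductive Runs : Prog → SExp → SExp → ℕ → Prop where
  | id (x : SExp) : Runs Prog.id x x x.size
  | nil (x : SExp) : Runs Prog.nil x SExp.nil x.size
  | fst (x : SExp) : Runs Prog.fst x x.fst x.size
  | snd (x : SExp) : Runs Prog.snd x x.snd x.size
  | pair {f g : Prog} {x y z : SExp} {a b : ℕ} :
      Runs f x y a → Runs g x z b → Runs (Prog.pair f g) x (SExp.cons y z) (a + b + x.size)
  | seq {f g : Prog} {x y z : SExp} {a b : ℕ} :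
      Runs f x y a → Runs g y z b → Runs (Prog.seq f g) x z (a + b + x.size)
  | ite_true {c f g : Prog} {x u v y : SExp} {a b : ℕ} :
      Runs c x (SExp.cons u v) a → Runs f x y b → Runs (Prog.ite c f g) x y (a + b + x.size)
  | ite_false {c f g : Prog} {x y : SExp} {a b : ℕ} :
      Runs c x SExp.nil a → Runs g x y b → Runs (Prog.ite c f g) x y (a + b + x.size)
  | loop_stop {c f : Prog} {x : SExp} {a : ℕ} :
      Runs c x SExp.nil a → Runs (Prog.loop c f) x x (a + x.size)
  | loop_step {c f : Prog} {x u v y z : SExp} {a b k : ℕ} :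
      Runs c x (SExp.cons u v) a → Runs f x y b → Runs (Prog.loop c f) y z k →
        Runs (Prog.loop c f) x z (a + b + k + x.size)

/-- Types whose elements are represented by S-expressions. -/
class Coded (A : Type) where
  code : A → SExp

instance instCodedBool : Coded Bool where
  code b := if b then SExp.cons SExp.nil SExp.nil else SExp.nil

instance instCodedList {A : Type} [Coded A] : Coded (List A) where
  code l := l.foldr (fun a s => SExp.cons (Coded.code a) s) SExp.nil

instance instCodedProd {A B : Type} [Coded A] [Coded B] : Coded (A × B) where
  code p := SExp.cons (Coded.code p.1) (Coded.code p.2)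

instance instCodedOption {A : Type} [Coded A] : Coded (Option A) where
  code o := match o with
    | none => SExp.nil
    | some a => SExp.cons (Coded.code a) SExp.nil

/-- `f` is computable in time polynomial in the size of the (code of the) argument. -/
def PolyTime {A B : Type} [Coded A] [Coded B] (f : A → B) : Prop :=
  ∃ (p : Prog) (T : Polynomial ℕ), ∀ a : A, ∃ k : ℕ,
    k ≤ T.eval (Coded.code a).size ∧ Runs p (Coded.code a) (Coded.code (f a)) k

/-! ### Inverting functions on bit strings -/

/-- A p.p.t. partial function `G(y, r)`: `r` is a uniformly random string of `coins(|y|)` bits,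
and the value `none` means that `G` is undefined. -/
structure PPT where
  run : List Bool → List Bool → Option (List Bool)
  coins : Polynomial ℕ
  polyTime : PolyTime (fun p : List Bool × List Bool => run p.1 p.2)

open Classical in
/-- The probability that `H (G (H x, r)) = H x`, for a length-preserving `H`, a uniformly random
`n`-bit string `x` and independent uniformly random coins `r` of `G`. -/
noncomputable def invProb (H : List Bool → List Bool) (n : ℕ) (G : PPT) : ℝ :=
  ((Finset.univ.filter
      (fun p : List.Vector Bool n × List.Vector Bool (G.coins.eval n) =>
        ∃ z : List Bool, G.run (H p.1.toList) p.2.toList = some z ∧ z.length = n ∧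
          H z = H p.1.toList)).card : ℝ) /
    (2 ^ n * 2 ^ (G.coins.eval n))

/-- `p(n) = n^{-O(1)}`. -/
def Significant (p : ℕ → ℝ) : Prop :=
  ∃ k : ℝ, 0 < k ∧ ∀ᶠ n : ℕ in Filter.atTop, (n : ℝ) ^ (-k) ≤ p n

/-- `p(n) = n^{-ω(1)}`. -/
def Negligible (p : ℕ → ℝ) : Prop :=
  ∀ k : ℝ, 0 < k → ∀ᶠ n : ℕ in Filter.atTop, p n ≤ (n : ℝ) ^ (-k)

/-- `F` restricts to a bijection of `{0,1}^n` for every `n`. -/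
def IsStringPermutation (F : List Bool → List Bool) : Prop :=
  ∀ n : ℕ, Set.BijOn F {x | x.length = n} {x | x.length = n}

/-- Weakly one-way permutations. -/
def IsWeaklyOneWayPermutation (F : List Bool → List Bool) : Prop :=
  PolyTime F ∧ IsStringPermutation F ∧
    ∃ k : ℝ, 0 < k ∧ ∀ G : PPT, ∀ᶠ n : ℕ in Filter.atTop, invProb F n G ≤ 1 - (n : ℝ) ^ (-k)

/-! ### Fully explicit expander graph families -/

/-- `R` is a rotation function for a family of `2^e`-regular graphs on the vertex sets
`{0,1}^{c m}`, `m ≥ 0`: `R u j = (v, k)` says that the `j`-th edge at `u` is the `k`-th edge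
at `v`.  (Loops and parallel edges are allowed.) -/
def IsRotation (c e : ℕ) (R : List Bool → List Bool → List Bool × List Bool) : Prop :=
  ∀ (m : ℕ) (u j : List Bool), u.length = c * m → j.length = e →
    (R u j).1.length = c * m ∧ (R u j).2.length = e ∧ R (R u j).1 (R u j).2 = (u, j)

/-- The transition matrix of the graph on `{0,1}^n` with rotation function `R`: the proportion of
the `2^e` edges at `u` that lead to `v`. -/
noncomputable def transitionMatrix (e : ℕ) (R : List Bool → List Bool → List Bool × List Bool)
    (n : ℕ) : Matrix (List.Vector Bool n) (List.Vector Bool n) ℝ :=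
  fun u v =>
    ((Finset.univ.filter
      (fun j : List.Vector Bool e => (R u.toList j.toList).1 = v.toList)).card : ℝ) / 2 ^ e

/-- All eigenvalues of a (symmetric, doubly stochastic) matrix other than the eigenvalue `1` of the
constant vectors have absolute value at most `α`; the eigenvectors orthogonal to the constant
vectors account for these eigenvalues with multiplicity.  For `α < 1` this forces the graph to be
connected and not bipartite. -/
def SecondEigenvalueLE {V : Type} [Fintype V] (A : Matrix V V ℝ) (α : ℝ) : Prop :=
  ∀ (f : V → ℝ) (μ : ℝ), f ≠ 0 → ∑ v, f v = 0 → A.mulVec f = μ • f → |μ| ≤ α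

/-- A fully explicit family of `(2^{c m}, 2^e, α)`-expander graphs, `m ≥ 0`, given by its
polynomial time computable rotation function. -/
def IsFullyExplicitExpander (c e : ℕ) (α : ℝ)
    (R : List Bool → List Bool → List Bool × List Bool) : Prop :=
  IsRotation c e R ∧
    PolyTime (fun p : List Bool × List Bool => R p.1 p.2) ∧
    ∀ m : ℕ, SecondEigenvalueLE (transitionMatrix e R (c * m)) α

/-! ### The expander-permutation walk construction -/

/-- Directed walks in the graph with edges `(u, F v)`, for the edges `{u, v}` of the graph with
rotation function `R`.  `IsWalk F R x l y`: there is a walk from `x` to `y` whose successive edges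
carry the pairs `(κ, κ')` of colours listed in `l`, where `R u κ = (v, κ')` for the edge
`(u, F v)`. -/
inductive IsWalk (F : List Bool → List Bool) (R : List Bool → List Bool → List Bool × List Bool) :
    List Bool → List (List Bool × List Bool) → List Bool → Prop where
  | nil (x : List Bool) : IsWalk F R x [] x
  | cons {x y v k k' : List Bool} {l : List (List Bool × List Bool)} :
      R x k = (v, k') → IsWalk F R (F v) l y → IsWalk F R x ((k, k') :: l) y

/-- The forward representation `(x₀, κ₁, …, κₜ)` of a walk. -/
def forwardRep (x₀ : List Bool) (l : List (List Bool × List Bool)) : List Bool :=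
  x₀ ++ (l.map Prod.fst).flatten

/-- The reverse representation `(xₜ, κ'ₜ, …, κ'₁)` of a walk. -/
def reverseRep (l : List (List Bool × List Bool)) (xₜ : List Bool) : List Bool :=
  xₜ ++ (l.map Prod.snd).reverse.flatten

/-- Starting at `x`, make `t` steps, following the edges whose `e`-bit colours are listed in `w`,
and apply `F` after each; return the final vertex followed by the colours `κ'` of the edges used,
the last edge first (`acc` holds the colours `κ'` collected before). -/
def walkAux (F : List Bool → List Bool) (R : List Bool → List Bool → List Bool × List Bool)
    (e : ℕ) : ℕ → List Bool → List Bool → List Bool → List Bool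
  | 0, x, _, acc => x ++ acc
  | t + 1, x, w, acc =>
      walkAux F R e t (F (R x (w.take e)).1) (w.drop e) ((R x (w.take e)).2 ++ acc)

/-- The function `F'` on `{0,1}^{n + t e}`, which takes the forward representation of each directed
`t`-walk on `{0,1}^n` to its reverse representation. -/
def walkPerm (F : List Bool → List Bool) (R : List Bool → List Bool → List Bool × List Bool)
    (e n t : ℕ) (w : List Bool) : List Bool :=
  walkAux F R e t (w.take n) (w.drop n) []

theorem walkAux_flatten (F : List Bool → List Bool)
    (R : List Bool → List Bool → List Bool × List Bool) (e : ℕ) {x y : List Bool}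
    {l : List (List Bool × List Bool)} (h : IsWalk F R x l y) :
    ∀ (acc : List Bool), (∀ p ∈ l, p.1.length = e) →
      walkAux F R e l.length x (l.map Prod.fst).flatten acc = reverseRep l y ++ acc := by
  induction h with
  | nil x => intro acc _; simp [walkAux, reverseRep]
  | @cons x y v k k' l hR hw ih =>
      intro acc hl
      have hk : k.length = e := hl (k, k') (by simp)
      have hl' : ∀ p ∈ l, p.1.length = e := fun p hp => hl p (by simp [hp])
      subst hk
      simp [walkAux, hR, ih _ hl', reverseRep]

/-- `F' ∘ φ = ρ` for the forward and reverse representations `φ` and `ρ`. -/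
theorem walkPerm_forwardRep (F : List Bool → List Bool)
    (R : List Bool → List Bool → List Bool × List Bool) (e : ℕ) {x y : List Bool}
    {l : List (List Bool × List Bool)} (h : IsWalk F R x l y) (hl : ∀ p ∈ l, p.1.length = e) :
    walkPerm F R e x.length l.length (forwardRep x l) = reverseRep l y := by
  simp [walkPerm, forwardRep, walkAux_flatten F R e h [] hl]

/-- The input length `n + t(n) e` of `F'` for `n = c m`. -/
def walkLength (c e : ℕ) (t : ℕ → ℕ) (m : ℕ) : ℕ :=
  c * m + t (c * m) * e

/-- The extension of `F'` to strings `w` of every length: for the largest `m` with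
`walkLength c e t m ≤ |w|`, apply `F'` to the first `walkLength c e t m` bits and keep the other
bits.  (For the finitely many lengths without such an `m`, the function is the identity.) -/
def walkPermExt (F : List Bool → List Bool) (R : List Bool → List Bool → List Bool × List Bool)
    (c e : ℕ) (t : ℕ → ℕ) (w : List Bool) : List Bool :=
  let m := Nat.findGreatest (fun i => walkLength c e t i ≤ w.length) w.length
  if walkLength c e t m ≤ w.length then
    walkPerm F R e (c * m) (t (c * m)) (w.take (walkLength c e t m)) ++
      w.drop (walkLength c e t m)
  else w

/-! ### Polynomials with natural coefficients -/

/-! The proof is a reduction: an inverter `G'` of walks yields an inverter of `F`. Given `y`, place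
it as vertex `i + 1` of a walk, choose random colours for the way back and for the way forward, walk
on from `y` to the end and pass the reverse representation to `G'`. Every step of a walk is
reversible, so a successful `G'` returns the very walk through `y`; retracing its first `i` steps
and looking at the next edge gives `v` with `F v = y`. For fixed `i` and `y` this samples the walks
through `y` uniformly (`card_filter_invertedWalks_le`, `attempt_isSome`).

Call `y` hard if this succeeds with probability at most `θ` at every position `i`, and let `μ` be
the density of the hard vertices. Two estimates carry the proof. By `one_sub_invProb_le`, `M`
independent trials invert every vertex that is not hard except with probability `(1 - θ) ^ M`; as
`F` cannot be inverted with probability above `1 - δ`, this forces `μ ≥ 3δ/4`. By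
`invProb_walkPermPrefix_le`, a walk inverted by `G'` either avoids the hard vertices after its
start, which on an expander has probability at most `(1 - βμ) ^ t`
(`SecondEigenvalueLE.sum_stayProb_le`), or meets one, which by a union bound contributes at most
`tθ`. The slack between `3/4` and `1/2` absorbs `tθ` (`pow_add_le_max`).

The function `t` need not be computable, so the inverter cannot know its parameters. It tries all of
them, encoding numbers as lengths of suffixes of its coin string; since `F v = y` can be checked,
superfluous trials do no harm. One inverter therefore serves all polynomially bounded `t` and all
lengths `r` of an unchanged tail at once, and this uniformity gives the result for the extension to
every length. Polynomial time of the inverter is derived from closure under iteration with a unary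
counter (`PolyTime.iterate`) and under search through suffixes (`PolyTime.search_polyTime`). -/

theorem Polynomial.eval_le_eval_of_le (p : Polynomial ℕ) {a b : ℕ} (h : a ≤ b) :
    p.eval a ≤ p.eval b := by
  rw [Polynomial.eval_eq_sum_range, Polynomial.eval_eq_sum_range]
  gcongr

/-! ### Closure properties of polynomial time -/

theorem SExp.size_pos (x : SExp) : 0 < x.size := by
  cases x <;> simp [SExp.size]

theorem Runs.size_le {p : Prog} {x y : SExp} {k : ℕ} (h : Runs p x y k) : y.size ≤ k := by
  induction h with
  | id x => exact le_rfl
  | nil x => exact x.size_pos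
  | fst x => cases x <;> simp only [SExp.fst, SExp.size] <;> omega
  | snd x => cases x <;> simp only [SExp.snd, SExp.size] <;> omega
  | @pair f g x y z a b _ _ h₁ h₂ =>
      have := x.size_pos
      simp only [SExp.size]; omega
  | seq => omega
  | ite_true => omega
  | ite_false => omega
  | loop_stop => omega
  | loop_step => omega

namespace PolyTime

variable {A B C D : Type} [Coded A] [Coded B] [Coded C] [Coded D]

/-- The size of the code. -/
abbrev csize (a : A) : ℕ := (Coded.code a).size

theorem csize_pos (a : A) : 0 < csize a := SExp.size_pos _

theorem csize_prod (p : A × B) : csize p = csize p.1 + csize p.2 + 1 := rfl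

theorem csize_nil : csize ([] : List A) = 1 := rfl

theorem csize_cons (a : A) (l : List A) : csize (a :: l) = csize a + csize l + 1 := rfl

/-- Polynomial-time functions have results of polynomial size. -/
theorem exists_csize_le {f : A → B} (hf : PolyTime f) :
    ∃ T : Polynomial ℕ, ∀ a, csize (f a) ≤ T.eval (csize a) := by
  obtain ⟨p, T, h⟩ := hf
  refine ⟨T, fun a => ?_⟩
  obtain ⟨k, hk, hr⟩ := h a
  exact hr.size_le.trans hk

/-- Covers functions such as `cons` that merely reread the same S-expression at another type. -/
theorem of_code_eq {f : A → B} (h : ∀ a, Coded.code (f a) = Coded.code a) : PolyTime f :=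
  ⟨Prog.id, Polynomial.X, fun a => ⟨(Coded.code a).size, by simp, by rw [h]; exact Runs.id _⟩⟩

theorem of_code_eq_fst {f : A → B} (h : ∀ a, Coded.code (f a) = (Coded.code a).fst) :
    PolyTime f :=
  ⟨Prog.fst, Polynomial.X, fun a => ⟨(Coded.code a).size, by simp, by rw [h]; exact Runs.fst _⟩⟩

theorem of_code_eq_snd {f : A → B} (h : ∀ a, Coded.code (f a) = (Coded.code a).snd) :
    PolyTime f :=
  ⟨Prog.snd, Polynomial.X, fun a => ⟨(Coded.code a).size, by simp, by rw [h]; exact Runs.snd _⟩⟩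

protected theorem id : PolyTime (fun a : A => a) := of_code_eq fun _ => rfl

theorem fst : PolyTime (fun p : A × B => p.1) := of_code_eq_fst fun _ => rfl

theorem snd : PolyTime (fun p : A × B => p.2) := of_code_eq_snd fun _ => rfl

theorem comp {g : B → C} {f : A → B} (hg : PolyTime g) (hf : PolyTime f) :
    PolyTime (fun a => g (f a)) := by
  obtain ⟨p, S, hp⟩ := hf
  obtain ⟨q, T, hq⟩ := hg
  refine ⟨Prog.seq p q, S + T.comp S + Polynomial.X, fun a => ?_⟩
  obtain ⟨k, hk, hr⟩ := hp a
  obtain ⟨l, hl, hs⟩ := hq (f a)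
  refine ⟨_, ?_, Runs.seq hr hs⟩
  have := T.eval_le_eval_of_le (hr.size_le.trans hk)
  simp only [Polynomial.eval_add, Polynomial.eval_comp, Polynomial.eval_X]
  omega

theorem pair {f : A → B} {g : A → C} (hf : PolyTime f) (hg : PolyTime g) :
    PolyTime (fun a => (f a, g a)) := by
  obtain ⟨p, S, hp⟩ := hf
  obtain ⟨q, T, hq⟩ := hg
  refine ⟨Prog.pair p q, S + T + Polynomial.X, fun a => ?_⟩
  obtain ⟨k, hk, hr⟩ := hp a
  obtain ⟨l, hl, hs⟩ := hq a
  refine ⟨_, ?_, Runs.pair hr hs⟩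
  simp only [Polynomial.eval_add, Polynomial.eval_X]
  omega

theorem const (b : B) : PolyTime (fun _ : A => b) := by
  suffices h : ∀ s : SExp, ∃ (p : Prog) (T : Polynomial ℕ), ∀ x : SExp,
      ∃ k : ℕ, k ≤ T.eval x.size ∧ Runs p x s k by
    obtain ⟨p, T, h⟩ := h (Coded.code b)
    exact ⟨p, T, fun a => h _⟩
  intro s
  induction s with
  | nil => exact ⟨Prog.nil, Polynomial.X, fun x => ⟨_, by simp, Runs.nil x⟩⟩
  | cons s₁ s₂ h₁ h₂ =>
    obtain ⟨p, S, hp⟩ := h₁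
    obtain ⟨q, T, hq⟩ := h₂
    refine ⟨Prog.pair p q, S + T + Polynomial.X, fun x => ?_⟩
    obtain ⟨k, hk, hr⟩ := hp x
    obtain ⟨l, hl, hs⟩ := hq x
    refine ⟨_, ?_, Runs.pair hr hs⟩
    simp only [Polynomial.eval_add, Polynomial.eval_X]
    omega

theorem ite {d : A → D} {f g : A → B} {P : A → Prop} [DecidablePred P] (hd : PolyTime d)
    (hP : ∀ a, P a ↔ Coded.code (d a) ≠ SExp.nil) (hf : PolyTime f) (hg : PolyTime g) :
    PolyTime (fun a => if P a then f a else g a) := by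
  obtain ⟨o, Q, ho⟩ := hd
  obtain ⟨p, S, hp⟩ := hf
  obtain ⟨q, T, hq⟩ := hg
  refine ⟨Prog.ite o p q, Q + S + T + Polynomial.X, fun a => ?_⟩
  obtain ⟨j, hj, hr⟩ := ho a
  simp only [Polynomial.eval_add, Polynomial.eval_X]
  by_cases h : P a
  · obtain ⟨k, hk, hs⟩ := hp a
    rw [if_pos h]
    have h' := (hP a).1 h
    cases hc : Coded.code (d a) with
    | nil => exact absurd hc h'
    | cons u v =>
      rw [hc] at hr
      exact ⟨_, by omega, Runs.ite_true hr hs⟩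
  · obtain ⟨k, hk, hs⟩ := hq a
    rw [if_neg h]
    have h' : Coded.code (d a) = SExp.nil := by
      by_contra hc
      exact h ((hP a).2 hc)
    rw [h'] at hr
    exact ⟨_, by omega, Runs.ite_false hr hs⟩

theorem code_list_ne_nil (l : List A) : Coded.code l ≠ SExp.nil ↔ l ≠ [] := by
  cases l <;> simp [Coded.code]

theorem code_option_ne_nil (o : Option A) : Coded.code o ≠ SExp.nil ↔ o.isSome := by
  cases o <;> simp [Coded.code]

theorem code_bool_ne_nil (b : Bool) : Coded.code b ≠ SExp.nil ↔ b = true := by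
  cases b <;> simp [Coded.code]

protected theorem some : PolyTime (fun a : A => some a) := by
  -- `some a` and `(a, [])` have the same code.
  obtain ⟨p, T, h⟩ := pair (PolyTime.id (A := A)) (const ([] : List Bool))
  exact ⟨p, T, h⟩

theorem cons : PolyTime (fun p : A × List A => p.1 :: p.2) := of_code_eq fun _ => rfl

theorem tail : PolyTime (fun l : List A => l.tail) :=
  of_code_eq_snd fun l => by cases l <;> rfl

/-- The default `false`, like `[]` in `getD`, is coded by `nil`, which is also the left component of
`nil`. -/
theorem headD : PolyTime (fun l : List Bool => l.headD false) :=
  of_code_eq_fst fun l => by cases l <;> rfl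

theorem getD : PolyTime (fun o : Option (List A) => o.getD []) :=
  of_code_eq_fst fun o => by cases o <;> rfl

/-- The loop runs on a pair of a value and a unary counter, dropping one bit of the counter per
round. As `M` bounds all iterates, each round costs at most `T.eval M` plus bookkeeping, for which
the factor `10` is generous. -/
theorem loop_iterate {p : Prog} {T : Polynomial ℕ} {f : A → A} {a : A} {M : ℕ}
    (hp : ∀ a : A, ∃ k : ℕ, k ≤ T.eval (csize a) ∧ Runs p (Coded.code a) (Coded.code (f a)) k)
    (u : List Bool) (hM : ∀ k ≤ u.length, csize (f^[k] a) ≤ M) :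
    ∃ k : ℕ, k ≤ (T.eval M + 10 * (M + csize u + 1)) * (u.length + 1) ∧
      Runs (Prog.loop Prog.snd (Prog.pair (Prog.seq Prog.fst p) (Prog.seq Prog.snd Prog.snd)))
        (Coded.code (a, u)) (Coded.code (f^[u.length] a, ([] : List Bool))) k := by
  induction u generalizing a with
  | nil =>
    refine ⟨_, ?_, Runs.loop_stop (Runs.snd _)⟩
    have := hM 0 le_rfl
    simp only [Function.iterate_zero, id] at this
    have h2 := csize_prod (a, ([] : List Bool))
    simp only [csize_nil] at h2 ⊢
    simp only [csize] at this h2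
    simp only [h2, List.length_nil]
    omega
  | cons b u ih =>
    have ha : csize a ≤ M := hM 0 (Nat.zero_le _)
    have hfa : csize (f a) ≤ M := hM 1 (by simp)
    obtain ⟨k, hk, hr⟩ := hp a
    obtain ⟨l, hl, hs⟩ := ih (a := f a) fun k hk => by
      rw [← Function.iterate_succ_apply]
      exact hM (k + 1) (by simpa using hk)
    have step : Runs (Prog.pair (Prog.seq Prog.fst p) (Prog.seq Prog.snd Prog.snd))
        (Coded.code (a, b :: u)) (Coded.code (f a, u)) _ :=
      Runs.pair (Runs.seq (Runs.fst _) hr) (Runs.seq (Runs.snd _) (Runs.snd _))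
    refine ⟨_, ?_, Runs.loop_step (u := Coded.code b) (v := Coded.code u) (Runs.snd _) step hs⟩
    have h1 := T.eval_le_eval_of_le ha
    have h2 := csize_prod (a, b :: u)
    have h3 := csize_cons b u
    have h4 : (Coded.code (a, b :: u)).snd.size = csize (b :: u) := rfl
    simp only [csize] at *
    have h5 : (T.eval M + 10 * (M + (Coded.code u).size + 1)) * (u.length + 1) ≤
        (T.eval M + 10 * (M + (Coded.code (b :: u)).size + 1)) * (u.length + 1) := by
      gcongr; omega
    rw [h4, List.length_cons, mul_add _ (u.length + 1) 1, mul_one]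
    omega

theorem length_lt_csize (l : List A) : l.length < csize l := by
  induction l with
  | nil => simp [csize_nil]
  | cons a l ih => rw [csize_cons, List.length_cons]; omega

/-- Iteration, the number of steps being given in unary, if the iterates do not grow too much. -/
theorem iterate {f : A → A} (hf : PolyTime f) (S : Polynomial ℕ)
    (hS : ∀ a k, csize (f^[k] a) ≤ S.eval (csize a + k)) :
    PolyTime (fun p : A × List Bool => f^[p.2.length] p.1) := by
  obtain ⟨p, T, hp⟩ := hf
  refine ⟨Prog.seq (Prog.loop Prog.snd
      (Prog.pair (Prog.seq Prog.fst p) (Prog.seq Prog.snd Prog.snd))) Prog.fst,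
    (T.comp S + 10 * (S + Polynomial.X + 1)) * (Polynomial.X + 1) + S + 3 + Polynomial.X, ?_⟩
  rintro ⟨a, u⟩
  have hlen := length_lt_csize u
  have hsz := csize_prod (a, u)
  obtain ⟨k, hk, hr⟩ := loop_iterate (a := a) (M := S.eval (csize (a, u))) hp u fun k hk =>
    (hS a k).trans (S.eval_le_eval_of_le (by simp only at hsz; omega))
  refine ⟨_, ?_, Runs.seq hr (Runs.fst _)⟩
  have h1 : (Coded.code (f^[u.length] a, ([] : List Bool))).size =
    csize (f^[u.length] a) + 1 + 1 := rfl
  have h2 := (hS a u.length).trans (S.eval_le_eval_of_le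
    (show csize a + u.length ≤ csize (a, u) by simp only at hsz; omega))
  have h3 : (T.eval (S.eval (csize (a, u))) + 10 * (S.eval (csize (a, u)) + csize u + 1)) *
        (u.length + 1) ≤
      (T.eval (S.eval (csize (a, u))) + 10 * (S.eval (csize (a, u)) + csize (a, u) + 1)) *
        (csize (a, u) + 1) := by
    simp only at hsz
    gcongr <;> omega
  rw [h1]
  simp only [Polynomial.eval_add, Polynomial.eval_mul, Polynomial.eval_comp, Polynomial.eval_X,
    Polynomial.eval_one, Polynomial.eval_ofNat]
  simp only [csize] at *
  omega

theorem iterate_of_le {f : A → A} (hf : PolyTime f) (h : ∀ a, csize (f a) ≤ csize a) :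
    PolyTime (fun p : A × List Bool => f^[p.2.length] p.1) := by
  refine iterate hf Polynomial.X fun a k => ?_
  rw [Polynomial.eval_X]
  refine le_trans ?_ (Nat.le_add_right _ k)
  induction k with
  | zero => exact le_rfl
  | succ k ih => rw [Function.iterate_succ_apply']; exact (h _).trans ih

end PolyTime

namespace PolyTime

variable {A B C D : Type} [Coded A] [Coded B] [Coded C] [Coded D]

/-! ### Operations on bit strings -/

theorem csize_le_length (l : List Bool) : csize l ≤ 4 * l.length + 1 := by
  induction l with
  | nil => simp [csize_nil]
  | cons b l ih =>
    have : csize b ≤ 3 := by cases b <;> decide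
    rw [csize_cons, List.length_cons]; omega

theorem csize_drop_le (l : List A) (k : ℕ) : csize (l.drop k) ≤ csize l := by
  induction l generalizing k with
  | nil => simp
  | cons a l ih =>
    cases k with
    | zero => simp
    | succ k => rw [List.drop_succ_cons, csize_cons]; have := ih k; omega

theorem csize_take_le (l : List A) (k : ℕ) : csize (l.take k) ≤ csize l := by
  induction l generalizing k with
  | nil => simp
  | cons a l ih =>
    cases k with
    | zero => rw [List.take_zero, csize_nil, csize_cons]; omega
    | succ k => rw [List.take_succ_cons, csize_cons, csize_cons]; have := ih k; omega

theorem csize_append (l l' : List A) : csize (l ++ l') + 1 = csize l + csize l' := by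
  induction l with
  | nil => rw [csize_nil, List.nil_append]; omega
  | cons a l ih => rw [List.cons_append, csize_cons, csize_cons]; omega

/-- Move the first bit of the first string to the front of the second string. -/
def moveHead (p : List Bool × List Bool) : List Bool × List Bool :=
  if p.1 ≠ [] then (p.1.tail, p.1.headD false :: p.2) else p

/-- Reversal, `drop`, `take` and concatenation are all read off from this iteration, with the length
of a string as the number of rounds. -/
theorem moveHead_iterate (k : ℕ) (l l' : List Bool) :
    moveHead^[k] (l, l') = (l.drop k, (l.take k).reverse ++ l') := by
  induction k generalizing l l' with
  | zero => simp
  | succ k ih =>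
    rw [Function.iterate_succ_apply]
    cases l with
    | nil => simpa [moveHead] using ih [] l'
    | cons b l => simp [moveHead, ih]

theorem moveHead_iterate_polyTime :
    PolyTime (fun p : (List Bool × List Bool) × List Bool => moveHead^[p.2.length] p.1) := by
  refine iterate_of_le (ite fst (fun p => (code_list_ne_nil p.1).symm)
    (pair (tail.comp fst) (cons.comp (pair (headD.comp fst) snd))) PolyTime.id) ?_
  rintro ⟨l, l'⟩
  cases l with
  | nil => simp [moveHead]
  | cons b l =>
    simp only [moveHead, csize_prod, csize_cons, ne_eq, reduceCtorEq, not_false_eq_true, if_true,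
      List.tail_cons, List.headD_cons]
    omega

theorem reverse : PolyTime (fun l : List Bool => l.reverse) := by
  have h := snd.comp (moveHead_iterate_polyTime.comp (pair (pair PolyTime.id (const [])) PolyTime.id))
  simpa only [moveHead_iterate, List.take_length, List.append_nil] using h

theorem drop : PolyTime (fun p : List Bool × List Bool => p.1.drop p.2.length) := by
  have h := fst.comp (moveHead_iterate_polyTime.comp (pair (pair fst (const [])) snd))
  simpa only [moveHead_iterate] using h

theorem take : PolyTime (fun p : List Bool × List Bool => p.1.take p.2.length) := by
  have h := reverse.comp (snd.comp
    (moveHead_iterate_polyTime.comp (pair (pair fst (const [])) snd)))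
  simpa only [moveHead_iterate, List.append_nil, List.reverse_reverse] using h

theorem append : PolyTime (fun p : List Bool × List Bool => p.1 ++ p.2) := by
  have h := snd.comp (moveHead_iterate_polyTime.comp (pair (pair (reverse.comp fst) snd) fst))
  simpa only [moveHead_iterate, List.take_length, List.reverse_reverse, List.take_reverse,
    Nat.sub_self, List.drop_zero] using h

/-- Remove the first bits of two strings if they agree. -/
def cancelHead (p : List Bool × List Bool) : List Bool × List Bool :=
  if p.1 ≠ [] then
    if p.2 ≠ [] then
      if p.1.headD false = true then
        if p.2.headD false = true then (p.1.tail, p.2.tail) else p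
      else if p.2.headD false = true then p else (p.1.tail, p.2.tail)
    else p
  else p

theorem cancelHead_iterate_polyTime :
    PolyTime (fun p : (List Bool × List Bool) × List Bool => cancelHead^[p.2.length] p.1) := by
  have htl : PolyTime (fun p : List Bool × List Bool => (p.1.tail, p.2.tail)) :=
    pair (tail.comp fst) (tail.comp snd)
  have h2 : ∀ {f g : List Bool × List Bool → List Bool × List Bool}, PolyTime f → PolyTime g →
      PolyTime (fun p => if p.2.headD false = true then f p else g p) :=
    ite (headD.comp snd) (fun p => (code_bool_ne_nil (p.2.headD false)).symm)
  refine iterate_of_le (ite fst (fun p => (code_list_ne_nil p.1).symm)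
    (ite snd (fun p => (code_list_ne_nil p.2).symm)
    (ite (headD.comp fst) (fun p => (code_bool_ne_nil (p.1.headD false)).symm)
      (h2 htl PolyTime.id) (h2 PolyTime.id htl)) PolyTime.id) PolyTime.id) ?_
  rintro ⟨l, l'⟩
  have h : csize (l.tail, l'.tail) ≤ csize (l, l') := by
    have h1 := csize_drop_le l 1
    have h2 := csize_drop_le l' 1
    rw [List.drop_one] at h1 h2
    rw [csize_prod, csize_prod]
    simp only at *
    omega
  unfold cancelHead
  split_ifs <;> first | exact h | exact le_rfl

/-- At a mismatch, or when just one string is exhausted, the step is stuck at a pair with a nonempty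
component; both strings vanish only if they agree bit by bit. -/
theorem cancelHead_iterate (l l' : List Bool) :
    l = l' ↔ cancelHead^[l.length] (l, l') = ([], []) := by
  induction l generalizing l' with
  | nil => simp [eq_comm]
  | cons b l ih =>
    rw [List.length_cons, Function.iterate_succ_apply]
    have hfix : ∀ {p : List Bool × List Bool}, cancelHead p = p → cancelHead^[l.length] p = p :=
      fun hp => Function.iterate_fixed hp _
    cases l' with
    | nil =>
      have h : cancelHead (b :: l, []) = (b :: l, []) := by simp [cancelHead]
      rw [h, hfix h]; simp
    | cons b' l' =>
      by_cases hb : b = b'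
      · subst hb
        have h : cancelHead (b :: l, b :: l') = (l, l') := by cases b <;> simp [cancelHead]
        rw [h, ← ih]; simp
      · have h : cancelHead (b :: l, b' :: l') = (b :: l, b' :: l') := by
          cases b <;> cases b' <;> simp_all [cancelHead]
        rw [h, hfix h]; simp [hb]

/-- Case distinction by equality of bit strings. -/
theorem ite_eq {f₁ f₂ : A → List Bool} {g h : A → B} (h₁ : PolyTime f₁) (h₂ : PolyTime f₂)
    (hg : PolyTime g) (hh : PolyTime h) : PolyTime (fun a => if f₁ a = f₂ a then g a else h a) := by
  have hd : PolyTime (fun a => cancelHead^[(f₁ a).length] (f₁ a, f₂ a)) :=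
    (cancelHead_iterate_polyTime.comp (pair (pair h₁ h₂) h₁) :)
  have key : PolyTime (fun a =>
      if (cancelHead^[(f₁ a).length] (f₁ a, f₂ a)).1 ≠ [] then h a
      else if (cancelHead^[(f₁ a).length] (f₁ a, f₂ a)).2 ≠ [] then h a else g a) :=
    ite (fst.comp hd) (fun a => (code_list_ne_nil _).symm) hh
      (ite (snd.comp hd) (fun a => (code_list_ne_nil _).symm) hh hg)
  convert key using 2 with a
  have h := cancelHead_iterate (f₁ a) (f₂ a)
  rw [Prod.ext_iff] at h
  by_cases h1 : (cancelHead^[(f₁ a).length] (f₁ a, f₂ a)).1 = [] <;>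
    by_cases h2 : (cancelHead^[(f₁ a).length] (f₁ a, f₂ a)).2 = [] <;> simp [h1, h2, h]

/-! ### Search through the suffixes of a string -/

/-- The first result of `f a` on the suffixes of `u`. -/
def search (f : A × List Bool → Option B) (u : A → List Bool) (a : A) : Option B :=
  (u a).tails.findSome? (fun s => f (a, s))

theorem search_isSome_iff {X Y : Type} {f : X × List Bool → Option Y} {u : X → List Bool} {a : X} :
    (search f u a).isSome ↔ ∃ s, s <:+ u a ∧ (f (a, s)).isSome := by
  rw [search, List.findSome?_isSome_iff]
  simp [List.mem_tails]

theorem exists_of_search_eq_some {X Y : Type} {f : X × List Bool → Option Y} {u : X → List Bool} {a : X} {b : Y}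
    (h : search f u a = Option.some b) : ∃ s, f (a, s) = Option.some b := by
  obtain ⟨s, -, hs⟩ := List.exists_of_findSome?_eq_some h
  exact ⟨s, hs⟩

/-- One step of the search. -/
def searchStep (f : A × List Bool → Option B) (p : (A × List Bool) × Option B) :
    (A × List Bool) × Option B :=
  ((p.1.1, p.1.2.tail), if p.2.isSome then p.2 else f p.1)

/-- A string has one more suffix than it has bits, the empty one included; hence the additional bit
`b` in the counter. -/
theorem searchStep_iterate {X Y : Type} (f : X × List Bool → Option Y) (a : X) (u : List Bool) (b : Bool) :
    (((searchStep f)^[(b :: u).length] ((a, u), none)).2) =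
      u.tails.findSome? (fun s => f (a, s)) := by
  have hsome : ∀ (k : ℕ) (u : List Bool) (o : Option Y), o.isSome →
      ((searchStep f)^[k] ((a, u), o)).2 = o := by
    intro k
    induction k with
    | zero => intro u o _; rfl
    | succ k ih =>
      intro u o ho
      rw [Function.iterate_succ_apply, searchStep, if_pos ho]
      exact ih _ _ ho
  induction u with
  | nil => cases h : f (a, []) <;> simp [searchStep, h]
  | cons b' u ih =>
    rw [List.length_cons, Function.iterate_succ_apply]
    cases h : f (a, b' :: u) with
    | none => simpa [searchStep, h] using ih
    | some c => simp [searchStep, h, hsome _ _ (Option.some c)]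

/-- Nothing accumulates during the search: the state holds the fixed argument, a shrinking suffix
and at most one result of `f`, so `iterate` applies. -/
theorem search_polyTime {f : A × List Bool → Option B} {u : A → List Bool} (hf : PolyTime f)
    (hu : PolyTime u) : PolyTime (search f u) := by
  obtain ⟨T, hT⟩ := exists_csize_le hf
  have hstep : PolyTime (searchStep f) :=
    pair (pair (fst.comp fst) (tail.comp (snd.comp fst)))
      (ite snd (fun p => (code_option_ne_nil p.2).symm) snd (hf.comp fst))
  have hit := iterate hstep (Polynomial.X + Polynomial.X + T + 1) ?_
  · have h := snd.comp (hit.comp (pair (pair (pair PolyTime.id hu) (const none))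
      (cons.comp (pair (const true) hu))))
    convert h using 2 with a
    exact (searchStep_iterate f a (u a) true).symm
  · rintro p k
    have hinv : ((searchStep f)^[k] p).1.1 = p.1.1 ∧
        csize ((searchStep f)^[k] p).1.2 ≤ csize p.1.2 ∧
        csize ((searchStep f)^[k] p).2 ≤ csize p + T.eval (csize p) := by
      have hp := csize_prod p
      have hp' := csize_prod p.1
      induction k with
      | zero => exact ⟨rfl, le_rfl, by simp only [Function.iterate_zero, id]; omega⟩
      | succ k ih =>
        rw [Function.iterate_succ_apply']
        set q := (searchStep f)^[k] p
        obtain ⟨h1, h2, h3⟩ := ih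
        refine ⟨h1, ?_, ?_⟩
        · have := csize_drop_le q.1.2 1
          rw [List.drop_one] at this
          exact this.trans h2
        · simp only [searchStep]
          split_ifs
          · exact h3
          · have hq := csize_prod q.1
            rw [h1] at hq
            have h4 := hT q.1
            have := T.eval_le_eval_of_le (show csize q.1 ≤ csize p by omega)
            omega
    obtain ⟨h1, h2, h3⟩ := hinv
    have hp := csize_prod p
    have hp' := csize_prod p.1
    have hq := csize_prod ((searchStep f)^[k] p)
    have hq' := csize_prod ((searchStep f)^[k] p).1
    rw [h1] at hq'
    have := T.eval_le_eval_of_le (Nat.le_add_right (csize p) k)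
    simp only [Polynomial.eval_add, Polynomial.eval_X, Polynomial.eval_one]
    omega

end PolyTime

/-! ### Walks, step by step -/

section Walk

variable (F : List Bool → List Bool) (R : List Bool → List Bool → List Bool × List Bool) (e : ℕ)

/-- One step of a walk.  The state consists of the current vertex, the remaining colours, and the
colours for the way back. -/
def walkStep (s : List Bool × List Bool × List Bool) : List Bool × List Bool × List Bool :=
  (F (R s.1 (s.2.1.take e)).1, s.2.1.drop e, (R s.1 (s.2.1.take e)).2 ++ s.2.2)

/-- One step of a walk on strings whose length is at most that of the first component. -/
def clippedStep (s : List Bool × List Bool × List Bool × List Bool) :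
    List Bool × List Bool × List Bool × List Bool :=
  (s.1, (walkStep F R e s.2).1.take s.1.length, (walkStep F R e s.2).2)

/-- Use `run` to find a preimage of `y`: walk from `y` for `|a|` steps, with the colours for the way
back preset to the first `|L|` bits of `S` and the colours for the way forward listed in the other
bits; let `run` try to invert the walk, with a tail of `|r|` bits and `|q|` coins; in the walk that
is found, make `|b|` steps and look at the next edge. -/
def attempt (run : List Bool → List Bool → Option (List Bool)) (y a L r q b S : List Bool) :
    Option (List Bool) :=
  let s := ((clippedStep F R e)^[a.length] (y, y, S.drop L.length, S.take L.length)).2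
  let z := (run (s.1 ++ (s.2.2 ++ s.2.1.take r.length))
    ((s.2.1.drop r.length).take q.length)).getD []
  let s' := ((clippedStep F R e)^[b.length] (y, z.take y.length, z.drop y.length, [])).2
  let v := (R s'.1 (s'.2.1.take e)).1
  if F v = y then some v else none

open PolyTime in
/-- All attempts in which each of the parameters is a suffix of the second argument. -/
def inverter (run : List Bool → List Bool → Option (List Bool)) :
    List Bool × List Bool → Option (List Bool) :=
  search (search (search (search (search (search
    (fun p : ((((((List Bool × List Bool) × List Bool) × List Bool) × List Bool) × List Bool) ×
        List Bool) × List Bool => attempt F R e run p.1.1.1.1.1.1.1 p.1.1.1.1.1.2 p.1.1.1.1.2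
          p.1.1.1.2 p.1.1.2 p.1.2 p.2)
    (fun p => p.1.1.1.1.1.2)) (fun p => p.1.1.1.1.2)) (fun p => p.1.1.1.2)) (fun p => p.1.1.2))
    (fun p => p.1.2)) (fun p => p.2)

end Walk

/-! ### Polynomial time of walks and of the inverter. -/

namespace PolyTime

variable {A : Type} [Coded A] {F : List Bool → List Bool}
  {R : List Bool → List Bool → List Bool × List Bool} {e : ℕ}
  {run : List Bool → List Bool → Option (List Bool)}

theorem take_const (e : ℕ) : PolyTime (fun l : List Bool => l.take e) := by
  have h := take.comp (pair (PolyTime.id (A := List Bool)) (const (List.replicate e true)))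
  simpa only [List.length_replicate] using h

theorem drop_const (e : ℕ) : PolyTime (fun l : List Bool => l.drop e) := by
  have h := drop.comp (pair (PolyTime.id (A := List Bool)) (const (List.replicate e true)))
  simpa only [List.length_replicate] using h

theorem walkStep (hF : PolyTime F) (hR : PolyTime (fun p : List Bool × List Bool => R p.1 p.2)) :
    PolyTime (walkStep F R e) := by
  have h1 : PolyTime (fun s : List Bool × List Bool × List Bool => R s.1 (s.2.1.take e)) :=
    (hR.comp (pair fst ((take_const e).comp
      (fst.comp (snd (A := List Bool) (B := List Bool × List Bool))))) :)
  exact pair (hF.comp (fst.comp h1)) (pair ((drop_const e).comp (fst.comp snd))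
    (append.comp (pair (snd.comp h1) (snd.comp snd))))

/-- Polynomial time is required on all inputs, and on strings of a wrong length nothing prevents `R`
from lengthening the vertex at each step. Clipping bounds the vertex by the first component, which
never changes; the unused colours shrink, and each step collects at most one result of `R` on an
argument of bounded size. -/
theorem clippedStep_iterate (hF : PolyTime F)
    (hR : PolyTime (fun p : List Bool × List Bool => R p.1 p.2)) :
    PolyTime (fun p : (List Bool × List Bool × List Bool × List Bool) × List Bool =>
      (clippedStep F R e)^[p.2.length] p.1) := by
  obtain ⟨T, hT⟩ := exists_csize_le hR
  have hw := (walkStep (e := e) hF hR).comp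
    (snd (A := List Bool) (B := List Bool × List Bool × List Bool))
  refine iterate (pair fst (pair (take.comp (pair (fst.comp hw) fst)) (snd.comp hw)))
    (4 * Polynomial.X + Polynomial.X + Polynomial.X * T.comp (4 * Polynomial.X) + 3) ?_
  intro s k
  have key : ∀ s' : List Bool × List Bool × List Bool × List Bool, csize s' = csize s'.1 +
      csize s'.2.1 + csize s'.2.2.1 + csize s'.2.2.2 + 3 := by
    intro s'
    rw [csize_prod, csize_prod, csize_prod]; omega
  have hs := key s
  have hinv : ((clippedStep F R e)^[k] s).1 = s.1 ∧
      csize ((clippedStep F R e)^[k] s).2.1 ≤ csize s.2.1 + 2 * csize s.1 ∧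
      csize ((clippedStep F R e)^[k] s).2.2.1 ≤ csize s.2.2.1 ∧
      csize ((clippedStep F R e)^[k] s).2.2.2 ≤
        csize s.2.2.2 + k * T.eval (4 * csize s) := by
    induction k with
    | zero => exact ⟨rfl, by simp, le_rfl, by simp⟩
    | succ k ih =>
      rw [Function.iterate_succ_apply']
      set q := (clippedStep F R e)^[k] s
      obtain ⟨h1, h2, h3, h4⟩ := ih
      refine ⟨h1, ?_, (csize_drop_le _ _).trans h3, ?_⟩
      · have h5 := csize_le_length ((_root_.walkStep F R e q.2).1.take q.1.length)
        have h6 := List.length_take_le q.1.length (_root_.walkStep F R e q.2).1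
        -- A bit adds 2 or 4 to the size of the code of a string, so strings of equal length have
        -- codes whose sizes differ by a factor of at most 2.
        have h7 : 2 * q.1.length + 1 ≤ csize q.1 := by
          generalize q.1 = l
          induction l with
          | nil => simp [csize_nil]
          | cons b l ih =>
            have := csize_pos b
            rw [csize_cons, List.length_cons]; omega
        rw [h1] at h6 h7
        simp only [clippedStep]
        rw [h1] at h5 ⊢
        omega
      · have h5 := hT (q.2.1, q.2.2.1.take e)
        have h6 := csize_take_le q.2.2.1 e
        have h7 := csize_prod (q.2.1, q.2.2.1.take e)
        have h8 := csize_prod (R q.2.1 (q.2.2.1.take e))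
        have h9 := csize_append (R q.2.1 (q.2.2.1.take e)).2 q.2.2.2
        have h10 := T.eval_le_eval_of_le
          (show csize (q.2.1, q.2.2.1.take e) ≤ 4 * csize s by simp only at *; omega)
        simp only [clippedStep, _root_.walkStep] at *
        rw [add_mul, one_mul]
        omega
  obtain ⟨h1, h2, h3, h4⟩ := hinv
  have h5 := key ((clippedStep F R e)^[k] s)
  have h6 : k * T.eval (4 * csize s) ≤ (csize s + k) * T.eval (4 * (csize s + k)) :=
    Nat.mul_le_mul (Nat.le_add_left _ _) (T.eval_le_eval_of_le (by omega))
  simp only [Polynomial.eval_add, Polynomial.eval_mul, Polynomial.eval_comp, Polynomial.eval_X,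
    Polynomial.eval_ofNat]
  rw [h1] at h5
  change csize ((clippedStep F R e)^[k] s) ≤ _
  omega

theorem attempt (hF : PolyTime F) (hR : PolyTime (fun p : List Bool × List Bool => R p.1 p.2))
    (hrun : PolyTime (fun p : List Bool × List Bool => run p.1 p.2))
    {y a L r q b S : A → List Bool} (hy : PolyTime y) (ha : PolyTime a) (hL : PolyTime L)
    (hr : PolyTime r) (hq : PolyTime q) (hb : PolyTime b) (hS : PolyTime S) :
    PolyTime (fun p => attempt F R e run (y p) (a p) (L p) (r p) (q p) (b p) (S p)) := by
  have hit := clippedStep_iterate (e := e) hF hR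
  have hs : PolyTime (fun p => ((clippedStep F R e)^[(a p).length]
      (y p, y p, (S p).drop (L p).length, (S p).take (L p).length)).2) :=
    (snd.comp (hit.comp (pair (pair hy (pair hy (pair (drop.comp (pair hS hL))
      (take.comp (pair hS hL))))) ha)) :)
  have hw := fst.comp (snd.comp hs)
  have hz := getD.comp (hrun.comp (pair (append.comp (pair (fst.comp hs) (append.comp
    (pair (snd.comp (snd.comp hs)) (take.comp (pair hw hr))))))
    (take.comp (pair (drop.comp (pair hw hr)) hq))))
  have hs' := snd.comp (hit.comp (pair (pair hy (pair (take.comp (pair hz hy))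
    (pair (drop.comp (pair hz hy)) (const [])))) hb))
  have hv := fst.comp (hR.comp (pair (fst.comp hs') ((take_const e).comp (fst.comp (snd.comp hs')))))
  exact ite_eq (hF.comp hv) hy (PolyTime.some.comp hv) (const none)

theorem inverter (hF : PolyTime F) (hR : PolyTime (fun p : List Bool × List Bool => R p.1 p.2))
    (hrun : PolyTime (fun p : List Bool × List Bool => run p.1 p.2)) :
    PolyTime (inverter F R e run) := by
  have p₁ := fst (A := List Bool × List Bool) (B := List Bool)
  have p₂ := p₁.comp (fst (B := List Bool))
  have p₃ := p₂.comp (fst (B := List Bool))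
  have p₄ := p₃.comp (fst (B := List Bool))
  have p₅ := p₄.comp (fst (B := List Bool))
  have p₆ := p₅.comp (fst (B := List Bool))
  have q₁ := (snd (A := List Bool × List Bool) (B := List Bool)).comp (fst (B := List Bool))
  have q₂ := q₁.comp (fst (B := List Bool))
  have q₃ := q₂.comp (fst (B := List Bool))
  have q₄ := q₃.comp (fst (B := List Bool))
  have q₅ := q₄.comp (fst (B := List Bool))
  exact search_polyTime (search_polyTime (search_polyTime (search_polyTime (search_polyTime
    (search_polyTime (attempt hF hR hrun (fst.comp p₆) q₅
      (snd.comp (fst.comp (fst.comp (fst.comp fst)))) (snd.comp (fst.comp (fst.comp fst)))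
      (snd.comp (fst.comp fst)) (snd.comp fst) snd)
    (snd.comp p₅)) (snd.comp p₄)) (snd.comp p₃)) (snd.comp p₂)) (snd.comp p₁)) snd

end PolyTime

/-! ### Correctness of the inverter. -/

section Walk

variable {F : List Bool → List Bool} {R : List Bool → List Bool → List Bool × List Bool} {e : ℕ}
  {run : List Bool → List Bool → Option (List Bool)}

/-- The concluding test in `attempt` guarantees this whatever the parameters and `run` are, which is
what makes an exhaustive search safe. -/
theorem eq_of_attempt_eq_some {y a L r q b S v : List Bool}
    (h : attempt F R e run y a L r q b S = some v) : F v = y := by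
  simp only [attempt] at h
  split_ifs at h with hv
  cases h
  exact hv

theorem eq_of_inverter_eq_some {y C v : List Bool} (h : inverter F R e run (y, C) = some v) :
    F v = y := by
  obtain ⟨_, h⟩ := PolyTime.exists_of_search_eq_some h
  obtain ⟨_, h⟩ := PolyTime.exists_of_search_eq_some h
  obtain ⟨_, h⟩ := PolyTime.exists_of_search_eq_some h
  obtain ⟨_, h⟩ := PolyTime.exists_of_search_eq_some h
  obtain ⟨_, h⟩ := PolyTime.exists_of_search_eq_some h
  obtain ⟨_, h⟩ := PolyTime.exists_of_search_eq_some h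
  exact eq_of_attempt_eq_some h

/-- One good choice of parameters suffices. All of them but `S` matter only through their lengths,
so every number up to the length of `C` is available. -/
theorem inverter_isSome {y C a L r q b S : List Bool} (ha : a <:+ C) (hL : L <:+ C) (hr : r <:+ C)
    (hq : q <:+ C) (hb : b <:+ C) (hS : S <:+ C)
    (h : (attempt F R e run y a L r q b S).isSome) : (inverter F R e run (y, C)).isSome :=
  PolyTime.search_isSome_iff.2 ⟨a, ha, PolyTime.search_isSome_iff.2 ⟨L, hL,
    PolyTime.search_isSome_iff.2 ⟨r, hr, PolyTime.search_isSome_iff.2 ⟨q, hq,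
      PolyTime.search_isSome_iff.2 ⟨b, hb, PolyTime.search_isSome_iff.2 ⟨S, hS, h⟩⟩⟩⟩⟩⟩

end Walk

/-! ### Random walks on expanders that avoid a set -/

section Expander

open scoped InnerProductSpace

/-- Parseval's identity in an orthonormal eigenbasis. -/
theorem LinearMap.IsSymmetric.norm_apply_le_of_eigenvalues {E : Type*} [NormedAddCommGroup E]
    [InnerProductSpace ℝ E] [FiniteDimensional ℝ E] {T : E →ₗ[ℝ] E} (hT : T.IsSymmetric) {a : ℝ}
    (ha : 0 ≤ a) (h : ∀ (f : E) (μ : ℝ), f ≠ 0 → T f = μ • f → |μ| ≤ a) (f : E) :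
    ‖T f‖ ≤ a * ‖f‖ := by
  set b := hT.eigenvectorBasis rfl
  have hb : ∀ i, |hT.eigenvalues rfl i| ≤ a := fun i =>
    h (b i) _ (b.orthonormal.ne_zero i) (hT.apply_eigenvectorBasis rfl i)
  refine le_of_sq_le_sq ?_ (by positivity)
  rw [mul_pow, ← b.sum_sq_norm_inner_right, ← b.sum_sq_norm_inner_right, Finset.mul_sum]
  refine Finset.sum_le_sum fun i _ => ?_
  rw [← hT, hT.apply_eigenvectorBasis rfl i, inner_smul_left, norm_mul, mul_pow]
  refine mul_le_mul_of_nonneg_right ?_ (by positivity)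
  exact pow_le_pow_left₀ (by positivity) (hb i) 2

variable {V : Type} [Fintype V]

/-- The all-ones matrix, divided by the number of rows. -/
noncomputable def meanMatrix (V : Type) [Fintype V] : Matrix V V ℝ := fun _ _ => (Fintype.card V : ℝ)⁻¹

theorem meanMatrix_mulVec (f : V → ℝ) (v : V) :
    (meanMatrix V).mulVec f v = (Fintype.card V : ℝ)⁻¹ * ∑ u, f u := by
  simp [meanMatrix, Matrix.mulVec, dotProduct, Finset.mul_sum]

theorem sum_mulVec_of_symm {A : Matrix V V ℝ} (hA : A.IsSymm) (h1 : ∀ u, ∑ v, A u v = 1)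
    (f : V → ℝ) : ∑ u, A.mulVec f u = ∑ v, f v := by
  simp only [Matrix.mulVec, dotProduct]
  rw [Finset.sum_comm]
  refine Finset.sum_congr rfl fun v _ => ?_
  rw [← Finset.sum_mul]
  have : ∑ u, A u v = ∑ u, A v u := Finset.sum_congr rfl fun u _ => hA.apply v u
  rw [this, h1, one_mul]

/-- Summing the coordinates of the eigenvalue equation gives `α ∑ f = μ ∑ f`. If the sum vanishes,
the mean matrix kills `f`, so `f` is an eigenvector of `A` itself. -/
theorem SecondEigenvalueLE.eigenvalue_sub_mean {A : Matrix V V ℝ} {α : ℝ}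
    (hα : SecondEigenvalueLE A α) (hA : A.IsSymm) (h1 : ∀ u, ∑ v, A u v = 1) {f : V → ℝ} {μ : ℝ}
    (hf : f ≠ 0) (h : (A - (1 - α) • meanMatrix V).mulVec f = μ • f) :
    (∑ v, f v ≠ 0 ∧ μ = α) ∨ (∑ v, f v = 0 ∧ |μ| ≤ α) := by
  have hV : (Fintype.card V : ℝ) ≠ 0 := by
    have : Nonempty V := by
      by_contra hV
      rw [not_nonempty_iff] at hV
      exact hf (Subsingleton.elim _ _)
    exact_mod_cast Fintype.card_ne_zero
  rw [Matrix.sub_mulVec, Matrix.smul_mulVec] at h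
  by_cases hs : ∑ v, f v = 0
  · right
    refine ⟨hs, hα f μ hf hs ?_⟩
    rw [← h]
    ext v
    simp [meanMatrix_mulVec, hs]
  · left
    refine ⟨hs, ?_⟩
    have h2 := congrArg (fun g => ∑ v, g v) h
    simp only [Pi.sub_apply, Pi.smul_apply, Finset.sum_sub_distrib, sum_mulVec_of_symm hA h1,
      meanMatrix_mulVec, smul_eq_mul, ← Finset.mul_sum, Finset.sum_const, Finset.card_univ,
      nsmul_eq_mul] at h2
    field_simp at h2
    linarith

variable [DecidableEq V]

/-- A matrix as an operator on the Euclidean space. -/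
noncomputable abbrev euclOp (A : Matrix V V ℝ) : EuclideanSpace ℝ V →ₗ[ℝ] EuclideanSpace ℝ V :=
  Matrix.toEuclideanLin A

theorem isSymmetric_sub_mean {A : Matrix V V ℝ} (hA : A.IsSymm) (a : ℝ) :
    (euclOp (A - a • meanMatrix V)).IsSymmetric := by
  rw [Matrix.isSymmetric_toEuclideanLin_iff]
  refine Matrix.IsHermitian.ext fun i j => ?_
  simp [meanMatrix, hA.apply i j]

/-- If `α` were negative, no eigenvector could have sum zero, so every vector of an eigenbasis would
belong to the eigenvalue `α`. But two basis vectors have a nontrivial combination with sum zero,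
again an eigenvector. -/
theorem SecondEigenvalueLE.nonneg {A : Matrix V V ℝ} {α : ℝ}
    (hα : SecondEigenvalueLE A α) (hA : A.IsSymm) (h1 : ∀ u, ∑ v, A u v = 1)
    (hV : 1 < Fintype.card V) : 0 ≤ α := by
  by_contra hneg
  have hT := isSymmetric_sub_mean hA (1 - α)
  set b := hT.eigenvectorBasis rfl
  have hev : ∀ i, (A - (1 - α) • meanMatrix V).mulVec (b i) = hT.eigenvalues rfl i • ⇑(b i) :=
    fun i => congrArg WithLp.ofLp (hT.apply_eigenvectorBasis rfl i)
  have hne : ∀ i, (⇑(b i) : V → ℝ) ≠ 0 := fun i h =>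
    b.orthonormal.ne_zero i (by ext v; exact congrFun h v)
  have hb : ∀ i, ∑ v, b i v ≠ 0 ∧ hT.eigenvalues rfl i = α := fun i => by
    rcases hα.eigenvalue_sub_mean hA h1 (hne i) (hev i) with h | h
    · exact h
    · exact absurd ((abs_nonneg _).trans h.2) hneg
  have hcard : 1 < Module.finrank ℝ (EuclideanSpace ℝ V) := by rwa [finrank_euclideanSpace]
  let i : Fin (Module.finrank ℝ (EuclideanSpace ℝ V)) := ⟨0, by omega⟩
  let j : Fin (Module.finrank ℝ (EuclideanSpace ℝ V)) := ⟨1, hcard⟩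
  have hij : i ≠ j := by simp [i, j]
  set f : V → ℝ := (∑ v, b j v) • ⇑(b i) - (∑ v, b i v) • ⇑(b j) with hf
  have hf0 : f ≠ 0 := by
    intro h0
    have h2 : (∑ v, b j v) • b i - (∑ v, b i v) • b j = 0 := by ext v; exact congrFun h0 v
    have h3 := congrArg (fun g => ⟪b i, g⟫_ℝ) h2
    simp only [inner_sub_right, inner_smul_right, inner_zero_right, b.inner_eq_ite, hij, if_true,
      if_false] at h3
    exact (hb j).1 (by linarith)
  have hfe : (A - (1 - α) • meanMatrix V).mulVec f = α • f := by
    rw [hf, Matrix.mulVec_sub, Matrix.mulVec_smul, Matrix.mulVec_smul, hev, hev, (hb i).2,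
      (hb j).2, smul_sub, smul_comm α, smul_comm α]
  have hfs : ∑ v, f v = 0 := by
    simp only [hf, Pi.sub_apply, Pi.smul_apply, smul_eq_mul, Finset.sum_sub_distrib,
      ← Finset.mul_sum]
    ring
  rcases hα.eigenvalue_sub_mean hA h1 hf0 hfe with h | h
  · exact h.1 hfs
  · exact absurd ((abs_nonneg _).trans h.2) hneg

/-- Subtracting `(1 - α)` times the mean matrix lowers the eigenvalue `1` of the constants to `α`
and leaves the eigenvectors of sum zero alone. -/
theorem SecondEigenvalueLE.norm_sub_mean_le {A : Matrix V V ℝ} {α : ℝ}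
    (hα : SecondEigenvalueLE A α) (hA : A.IsSymm) (h1 : ∀ u, ∑ v, A u v = 1) (h0 : 0 ≤ α)
    (f : EuclideanSpace ℝ V) : ‖euclOp (A - (1 - α) • meanMatrix V) f‖ ≤ α * ‖f‖ := by
  refine (isSymmetric_sub_mean hA (1 - α)).norm_apply_le_of_eigenvalues h0 ?_ f
  intro f μ hf h
  rcases hα.eigenvalue_sub_mean hA h1 (f := ⇑f) (μ := μ) (fun h0 => hf (by ext v; exact congrFun h0 v))
    (congrArg WithLp.ofLp h) with h | h
  · rw [h.2, abs_of_nonneg h0]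
  · exact h.2

/-- The restriction of a vector to a set of coordinates. -/
noncomputable def restrictTo (S : Finset V) (f : V → ℝ) : EuclideanSpace ℝ V :=
  WithLp.toLp 2 (fun v => if v ∈ S then f v else 0)

theorem norm_restrictTo_le (S : Finset V) (f : EuclideanSpace ℝ V) : ‖restrictTo S f‖ ≤ ‖f‖ := by
  rw [EuclideanSpace.norm_eq, EuclideanSpace.norm_eq]
  refine Real.sqrt_le_sqrt (Finset.sum_le_sum fun v _ => ?_)
  simp only [restrictTo]
  split_ifs <;> simp [sq_nonneg]

theorem norm_restrictTo_one (S : Finset V) (a : ℝ) :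
    ‖restrictTo S (fun _ => a)‖ = |a| * √S.card := by
  rw [EuclideanSpace.norm_eq, ← Real.sqrt_sq_eq_abs, ← Real.sqrt_mul (sq_nonneg a)]
  simp [restrictTo, apply_ite, Finset.sum_ite_mem, mul_comm]

theorem abs_sum_le_sqrt_mul_norm (S : Finset V) (f : EuclideanSpace ℝ V)
    (hf : ∀ v, v ∉ S → f v = 0) : |∑ v, f v| ≤ √S.card * ‖f‖ := by
  have h := abs_real_inner_le_norm (restrictTo S (fun _ => 1)) f
  rw [norm_restrictTo_one, abs_one, one_mul] at h
  convert h using 2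
  rw [PiLp.inner_apply]
  refine Finset.sum_congr rfl fun v _ => ?_
  by_cases hv : v ∈ S <;> simp [restrictTo, hv, hf]

/-- Split `A` into `1 - α` times the mean matrix and a remainder of norm at most `α`. For the mean
matrix, Cauchy–Schwarz on the support `S'` and the norm of a constant on `S` contribute a factor
`√S.card` each, which together give the density. The sets may differ because the permutation between
two steps moves the support. -/
theorem SecondEigenvalueLE.norm_restrict_le {A : Matrix V V ℝ} {α : ℝ}
    (hα : SecondEigenvalueLE A α) (hA : A.IsSymm) (h1 : ∀ u, ∑ v, A u v = 1) (h0 : 0 ≤ α)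
    (hα1 : α ≤ 1) {S S' : Finset V} (hS : S'.card = S.card)
    (f : EuclideanSpace ℝ V) (hf : ∀ v, v ∉ S' → f v = 0) :
    ‖restrictTo S (A.mulVec f)‖ ≤
      ((1 - α) * (S.card / Fintype.card V) + α) * ‖f‖ := by
  have hdec : restrictTo S (A.mulVec f) =
      restrictTo S (fun _ => (1 - α) * ((Fintype.card V : ℝ)⁻¹ * ∑ u, f u)) +
      restrictTo S (euclOp (A - (1 - α) • meanMatrix V) f) := by
    ext v
    have h2 : (euclOp (A - (1 - α) • meanMatrix V) f) v =
        (A - (1 - α) • meanMatrix V).mulVec f v := rfl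
    simp only [restrictTo, PiLp.add_apply, h2, Matrix.sub_mulVec, Matrix.smul_mulVec, Pi.sub_apply,
      Pi.smul_apply, meanMatrix_mulVec, smul_eq_mul]
    split_ifs <;> ring
  rw [hdec]
  refine (norm_add_le _ _).trans ?_
  rw [add_mul]
  refine add_le_add ?_ ((norm_restrictTo_le _ _).trans (hα.norm_sub_mean_le hA h1 h0 f))
  rw [norm_restrictTo_one, abs_mul, abs_mul, abs_of_nonneg (sub_nonneg.2 hα1), abs_inv,
    Nat.abs_cast]
  have h3 := abs_sum_le_sqrt_mul_norm S' f hf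
  rw [hS] at h3
  calc (1 - α) * ((Fintype.card V : ℝ)⁻¹ * |∑ u, f u|) * √S.card
      ≤ (1 - α) * ((Fintype.card V : ℝ)⁻¹ * (√S.card * ‖f‖)) * √S.card := by
        have := sub_nonneg.2 hα1
        gcongr
    _ = (1 - α) * ((√S.card * √S.card) / Fintype.card V) * ‖f‖ := by ring
    _ = _ := by rw [Real.mul_self_sqrt (Nat.cast_nonneg _)]

/-- The probability that a `t`-step walk from `x` stays in `S` after the start; each step goes to a
random neighbour and then applies `φ`. -/
noncomputable def stayProb (A : Matrix V V ℝ) (φ : V → V) (S : Finset V) : ℕ → V → ℝ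
  | 0 => fun _ => 1
  | t + 1 => A.mulVec (fun v => if φ v ∈ S then stayProb A φ S t (φ v) else 0)

/-- Composition with the bijection `φ` preserves norms and turns the support `S` into its preimage,
which is equally large; each step then gains the factor of `norm_restrict_le`. -/
theorem SecondEigenvalueLE.norm_stayProb_le {A : Matrix V V ℝ} {α : ℝ}
    (hα : SecondEigenvalueLE A α) (hA : A.IsSymm) (h1 : ∀ u, ∑ v, A u v = 1) (h0 : 0 ≤ α)
    (hα1 : α ≤ 1) {φ : V → V} (hφ : φ.Bijective) (S : Finset V) (t : ℕ) :
    ‖restrictTo S (stayProb A φ S t)‖ ≤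
      ((1 - α) * (S.card / Fintype.card V) + α) ^ t * √S.card := by
  have hc : 0 ≤ (1 - α) * ((S.card : ℝ) / Fintype.card V) + α := by
    have := sub_nonneg.2 hα1
    positivity
  induction t with
  | zero =>
    have := norm_restrictTo_one S 1
    simp only [abs_one, one_mul] at this
    simp [stayProb, this]
  | succ t ih =>
    set e : V ≃ V := Equiv.ofBijective φ hφ
    have hnorm : ‖(WithLp.toLp 2 fun v => restrictTo S (stayProb A φ S t) (φ v) :
        EuclideanSpace ℝ V)‖ = ‖restrictTo S (stayProb A φ S t)‖ := by
      rw [EuclideanSpace.norm_eq, EuclideanSpace.norm_eq]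
      congr 1
      exact e.sum_comp fun v => ‖restrictTo S (stayProb A φ S t) v‖ ^ 2
    have h := hα.norm_restrict_le hA h1 h0 hα1 (S := S) (S' := S.map e.symm.toEmbedding)
      (Finset.card_map _) (WithLp.toLp 2 fun v => restrictTo S (stayProb A φ S t) (φ v)) ?_
    · rw [hnorm] at h
      refine h.trans ?_
      rw [pow_succ', mul_assoc]
      exact mul_le_mul_of_nonneg_left ih hc
    · intro v hv
      have hv' : φ v ∉ S := fun h => hv (Finset.mem_map.2 ⟨φ v, h, e.symm_apply_apply v⟩)
      simp [restrictTo, hv']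

/-- The start is not tested, so the first step only preserves the sum. Cauchy–Schwarz on `S` then
yields the density `s` of `S` in place of the last factor, and `s ≤ (1 - α) s + α` because `s ≤ 1`
and `0 ≤ α`. -/
theorem SecondEigenvalueLE.sum_stayProb_le {A : Matrix V V ℝ} {α : ℝ}
    (hα : SecondEigenvalueLE A α) (hA : A.IsSymm) (h1 : ∀ u, ∑ v, A u v = 1) (h0 : 0 ≤ α)
    (hα1 : α ≤ 1) {φ : V → V} (hφ : φ.Bijective) (S : Finset V) (t : ℕ) [Nonempty V] :
    ∑ v, stayProb A φ S t v ≤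
      ((1 - α) * (S.card / Fintype.card V) + α) ^ t * Fintype.card V := by
  have hV : (0 : ℝ) < Fintype.card V := by exact_mod_cast Fintype.card_pos
  have hSV : (S.card : ℝ) / Fintype.card V ≤ 1 := by
    rw [div_le_one hV]
    exact_mod_cast Finset.card_le_univ S
  cases t with
  | zero => simp [stayProb]
  | succ t =>
    have hc : 0 ≤ (1 - α) * ((S.card : ℝ) / Fintype.card V) + α := by
      have := sub_nonneg.2 hα1
      positivity
    have h2 : ∑ v, stayProb A φ S (t + 1) v = ∑ v, restrictTo S (stayProb A φ S t) v := by
      rw [stayProb, sum_mulVec_of_symm hA h1]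
      exact (Equiv.ofBijective φ hφ).sum_comp fun v => restrictTo S (stayProb A φ S t) v
    rw [h2]
    refine (le_abs_self _).trans ((abs_sum_le_sqrt_mul_norm S _ fun v hv => by
      simp [restrictTo, hv]).trans ?_)
    calc √S.card * ‖restrictTo S (stayProb A φ S t)‖
        ≤ √S.card * (((1 - α) * (S.card / Fintype.card V) + α) ^ t * √S.card) := by
          gcongr
          exact hα.norm_stayProb_le hA h1 h0 hα1 hφ S t
      _ = ((1 - α) * (S.card / Fintype.card V) + α) ^ t * (√S.card * √S.card) := by ring
      _ = ((1 - α) * (S.card / Fintype.card V) + α) ^ t *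
            ((S.card / Fintype.card V) * Fintype.card V) := by
          rw [Real.mul_self_sqrt (Nat.cast_nonneg _), div_mul_cancel₀ _ hV.ne']
      _ ≤ ((1 - α) * (S.card / Fintype.card V) + α) ^ t *
            (((1 - α) * (S.card / Fintype.card V) + α) * Fintype.card V) := by
          gcongr
          nlinarith
      _ = _ := by rw [pow_succ]; ring

end Expander

/-! ### Inverting walks -/

section Walk

variable {F : List Bool → List Bool} {R : List Bool → List Bool → List Bool × List Bool}
  {c e m : ℕ}

/-- The state of a walk before the first step. -/
def walkStart (n : ℕ) (W : List Bool) : List Bool × List Bool × List Bool :=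
  (W.take n, W.drop n, [])

/-- The reverse representation of a walk, followed by the colours not used. -/
def walkOutput (s : List Bool × List Bool × List Bool) : List Bool := s.1 ++ (s.2.2 ++ s.2.1)

/-- `walkPerm`, applied to the first `n + t e` bits of a string. -/
def walkPermPrefix (F : List Bool → List Bool)
    (R : List Bool → List Bool → List Bool × List Bool) (e n t : ℕ) (W : List Bool) : List Bool :=
  walkPerm F R e n t (W.take (n + t * e)) ++ W.drop (n + t * e)

theorem IsStringPermutation.length_eq (hF : IsStringPermutation F) (x : List Bool) :
    (F x).length = x.length := (hF x.length).mapsTo rfl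

theorem IsStringPermutation.injective (hF : IsStringPermutation F) : Function.Injective F := by
  intro x y h
  have hxy : y.length = x.length := by rw [← hF.length_eq, ← h, hF.length_eq]
  exact (hF x.length).injOn rfl hxy h

theorem walkStep_append {s : List Bool × List Bool × List Bool} (hs : e ≤ s.2.1.length)
    (v : List Bool) : walkStep F R e (s.1, s.2.1 ++ v, s.2.2) =
      ((walkStep F R e s).1, (walkStep F R e s).2.1 ++ v, (walkStep F R e s).2.2) := by
  simp [walkStep, List.take_append_of_le_length hs, List.drop_append_of_le_length hs]

section

variable (hF : IsStringPermutation F) (hR : IsRotation c e R)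
include hF hR

theorem length_walkStep {s : List Bool × List Bool × List Bool} (hs : s.1.length = c * m)
    (hw : e ≤ s.2.1.length) : (walkStep F R e s).1.length = c * m ∧
      (walkStep F R e s).2.1.length = s.2.1.length - e ∧
      (walkStep F R e s).2.2.length = s.2.2.length + e := by
  obtain ⟨h1, h2, -⟩ := hR m s.1 (s.2.1.take e) hs (List.length_take_of_le hw)
  refine ⟨by rw [walkStep, hF.length_eq, h1], by simp [walkStep], ?_⟩
  simp [walkStep, h2, add_comm]

theorem length_walkStep_iterate {k : ℕ} {s : List Bool × List Bool × List Bool}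
    (hs : s.1.length = c * m) (hw : k * e ≤ s.2.1.length) :
    ((walkStep F R e)^[k] s).1.length = c * m ∧
      ((walkStep F R e)^[k] s).2.1.length = s.2.1.length - k * e ∧
      ((walkStep F R e)^[k] s).2.2.length = s.2.2.length + k * e := by
  induction k with
  | zero => simpa using hs
  | succ k ih =>
    rw [add_mul, one_mul] at hw ⊢
    obtain ⟨h1, h2, h3⟩ := ih (by omega)
    obtain ⟨h4, h5, h6⟩ := length_walkStep hF hR h1 (by omega)
    rw [Function.iterate_succ_apply']
    exact ⟨h4, by omega, by omega⟩

theorem walkStep_iterate_append {k : ℕ} {s : List Bool × List Bool × List Bool}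
    (hs : s.1.length = c * m) (hw : k * e ≤ s.2.1.length) (v : List Bool) :
    (walkStep F R e)^[k] (s.1, s.2.1 ++ v, s.2.2) =
      (((walkStep F R e)^[k] s).1, ((walkStep F R e)^[k] s).2.1 ++ v,
        ((walkStep F R e)^[k] s).2.2) := by
  induction k with
  | zero => rfl
  | succ k ih =>
    rw [add_mul, one_mul] at hw
    obtain ⟨h1, h2, h3⟩ := length_walkStep_iterate hF hR (k := k) hs (by omega)
    rw [Function.iterate_succ_apply', Function.iterate_succ_apply', ih (by omega),
      walkStep_append (by omega)]

/-- A step can be undone: `F` is injective, the return colour occupies the first `e` collected bits,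
and `R` recovers the previous vertex and the colour used from them. -/
theorem walkStep_injective {s s' : List Bool × List Bool × List Bool}
    (hs : s.1.length = c * m) (hs' : s'.1.length = c * m) (hw : e ≤ s.2.1.length)
    (hw' : e ≤ s'.2.1.length) (h : walkStep F R e s = walkStep F R e s') : s = s' := by
  obtain ⟨h1, h2, h3⟩ := hR m s.1 (s.2.1.take e) hs (List.length_take_of_le hw)
  obtain ⟨h1', h2', h3'⟩ := hR m s'.1 (s'.2.1.take e) hs' (List.length_take_of_le hw')
  simp only [walkStep, Prod.mk.injEq] at h
  obtain ⟨ha, hb, hc⟩ := h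
  obtain ⟨hc, hd⟩ := List.append_inj hc (h2.trans h2'.symm)
  rw [hF.injective ha, hc, h3'] at h3
  obtain ⟨hx, hk⟩ := Prod.mk.inj h3
  have hw : s.2.1 = s'.2.1 := by
    rw [← List.take_append_drop e s.2.1, ← List.take_append_drop e s'.2.1, hb, hk]
  exact Prod.ext hx.symm (Prod.ext hw hd)

theorem walkStep_iterate_injective {k : ℕ} {s s' : List Bool × List Bool × List Bool}
    (hs : s.1.length = c * m) (hs' : s'.1.length = c * m) (hw : k * e ≤ s.2.1.length)
    (hw' : k * e ≤ s'.2.1.length) (h : (walkStep F R e)^[k] s = (walkStep F R e)^[k] s') :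
    s = s' := by
  induction k with
  | zero => exact h
  | succ k ih =>
    rw [add_mul, one_mul] at hw hw'
    obtain ⟨h1, h2, h3⟩ := length_walkStep_iterate hF hR (k := k) hs (by omega)
    obtain ⟨h1', h2', h3'⟩ := length_walkStep_iterate hF hR (k := k) hs' (by omega)
    rw [Function.iterate_succ_apply', Function.iterate_succ_apply'] at h
    exact ih (by omega) (by omega)
      (walkStep_injective hF hR h1 h1' (by omega) (by omega) h)

/-- On strings of the proper lengths all vertices have the length of `y`, and clipping changes
nothing. -/
theorem clippedStep_iterate {k : ℕ} {y : List Bool} {s : List Bool × List Bool × List Bool}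
    (hy : y.length = c * m) (hs : s.1.length = c * m) (hw : k * e ≤ s.2.1.length) :
    (clippedStep F R e)^[k] (y, s) = (y, (walkStep F R e)^[k] s) := by
  induction k with
  | zero => rfl
  | succ k ih =>
    rw [add_mul, one_mul] at hw
    obtain ⟨h1, h2, h3⟩ := length_walkStep_iterate hF hR (k := k) hs (by omega)
    have h4 := (length_walkStep hF hR h1 (by omega)).1
    rw [Function.iterate_succ_apply', Function.iterate_succ_apply', ih (by omega), clippedStep,
      List.take_of_length_le (by simp only; omega)]

theorem length_walkStart {k r : ℕ} {W : List Bool} (hW : W.length = c * m + r) (hk : k * e ≤ r) :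
    ((walkStep F R e)^[k] (walkStart (c * m) W)).1.length = c * m ∧
      ((walkStep F R e)^[k] (walkStart (c * m) W)).2.1.length = r - k * e ∧
      ((walkStep F R e)^[k] (walkStart (c * m) W)).2.2.length = k * e := by
  have := length_walkStep_iterate hF hR (k := k) (s := walkStart (c * m) W) (m := m)
    (by simp [walkStart, hW]) (by simp [walkStart, hW, hk])
  simpa [walkStart, hW] using this

theorem walkStart_iterate_injective {k r : ℕ} {W W' : List Bool} (hW : W.length = c * m + r)
    (hW' : W'.length = c * m + r) (hk : k * e ≤ r)
    (h : (walkStep F R e)^[k] (walkStart (c * m) W) =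
      (walkStep F R e)^[k] (walkStart (c * m) W')) : W = W' := by
  have h1 := walkStep_iterate_injective hF hR (m := m)
    (by simp [walkStart, hW]) (by simp [walkStart, hW']) (by simp [walkStart, hW, hk])
    (by simp [walkStart, hW', hk]) h
  simp only [walkStart, Prod.mk.injEq, and_true] at h1
  rw [← List.take_append_drop (c * m) W, ← List.take_append_drop (c * m) W', h1.1, h1.2]

/-- After `t` steps exactly the tail of `r` bits is unread, and it is passed on unchanged. In this
form injectivity follows from that of the single steps. -/
theorem walkPermPrefix_eq {t r : ℕ} {W : List Bool} (hW : W.length = c * m + (t * e + r)) :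
    walkPermPrefix F R e (c * m) t W =
      walkOutput ((walkStep F R e)^[t] (walkStart (c * m) W)) := by
  have haux : ∀ (t : ℕ) (s : List Bool × List Bool × List Bool),
      walkAux F R e t s.1 s.2.1 s.2.2 =
        ((walkStep F R e)^[t] s).1 ++ ((walkStep F R e)^[t] s).2.2 := by
    intro t
    induction t with
    | zero => intro s; rfl
    | succ t ih => intro s; rw [Function.iterate_succ_apply]; exact ih (walkStep F R e s)
  set W₀ := W.take (c * m + t * e)
  set v := W.drop (c * m + t * e)
  have hW₀ : W₀.length = c * m + t * e := by simp [W₀, hW]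
  have hWv : W = W₀ ++ v := (List.take_append_drop _ _).symm
  have hstart : walkStart (c * m) W =
      ((walkStart (c * m) W₀).1, (walkStart (c * m) W₀).2.1 ++ v, (walkStart (c * m) W₀).2.2) := by
    simp only [walkStart]
    rw [hWv, List.take_append_of_le_length (by omega), List.drop_append_of_le_length (by omega)]
  obtain ⟨h1, h2, h3⟩ := length_walkStart hF hR hW₀ le_rfl
  rw [hstart, walkStep_iterate_append hF hR (m := m) (by simp [walkStart, hW₀])
    (by simp [walkStart, hW₀])]
  have h4 : ((walkStep F R e)^[t] (walkStart (c * m) W₀)).2.1 = [] := by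
    rw [← List.length_eq_zero_iff, h2, Nat.sub_self]
  rw [walkOutput]
  simp only [h4, List.nil_append]
  rw [← List.append_assoc, ← haux]
  rfl

theorem walkPermPrefix_injective {t r : ℕ} {W W' : List Bool}
    (hW : W.length = c * m + (t * e + r)) (hW' : W'.length = c * m + (t * e + r))
    (h : walkPermPrefix F R e (c * m) t W = walkPermPrefix F R e (c * m) t W') : W = W' := by
  rw [walkPermPrefix_eq hF hR hW, walkPermPrefix_eq hF hR hW'] at h
  obtain ⟨h1, h2, h3⟩ := length_walkStart hF hR (k := t) hW (by omega)
  obtain ⟨h1', h2', h3'⟩ := length_walkStart hF hR (k := t) hW' (by omega)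
  obtain ⟨ha, hb⟩ := List.append_inj h (h1.trans h1'.symm)
  obtain ⟨hb, hc⟩ := List.append_inj hb (h3.trans h3'.symm)
  exact walkStart_iterate_injective hF hR hW hW' (by omega) (Prod.ext ha (Prod.ext hc hb))

/-- If `run` inverts a walk, then `attempt` finds the preimage of each of its vertices but the
first. -/
theorem attempt_isSome {t r i : ℕ} {run : List Bool → List Bool → Option (List Bool)}
    {W z ω a L r' q b v : List Bool} (hW : W.length = c * m + (t * e + r))
    (hrun : run (walkPermPrefix F R e (c * m) t W) ω = some z) (hz : z.length = W.length)
    (hinv : walkPermPrefix F R e (c * m) t z = walkPermPrefix F R e (c * m) t W)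
    (hi : i + 1 ≤ t) (ha : a.length = t - (i + 1)) (hL : L.length = (i + 1) * e)
    (hr : r'.length = r) (hq : q.length = ω.length) (hb : b.length = i) :
    (attempt F R e run ((walkStep F R e)^[i + 1] (walkStart (c * m) W)).1 a L r' q b
      (((walkStep F R e)^[i + 1] (walkStart (c * m) W)).2.2 ++
        (((walkStep F R e)^[i + 1] (walkStart (c * m) W)).2.1 ++ ω) ++ v)).isSome := by
  -- Injectivity identifies the result of `run` with the walk itself, so retracing `z` visits the
  -- vertices of `W`.
  obtain rfl : z = W := walkPermPrefix_injective hF hR (hz.trans hW) hW hinv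
  have hle : (i + 1) * e + (t - (i + 1)) * e = t * e := by
    rw [← add_mul]; congr 1; omega
  obtain ⟨h1, h2, h3⟩ := length_walkStart hF hR (k := i + 1) hW (by omega)
  obtain ⟨h1t, h2t, h3t⟩ := length_walkStart hF hR (k := t) hW (by omega)
  set s := (walkStep F R e)^[i + 1] (walkStart (c * m) z) with hs
  have hst : (walkStep F R e)^[t - (i + 1)] s = (walkStep F R e)^[t] (walkStart (c * m) z) := by
    rw [hs, ← Function.iterate_add_apply]; congr 1; omega
  -- The sampled string consists of the colours back to the start, the remaining colours with the
  -- tail, the coins of `run`, and a surplus `v` that is ignored.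
  have hS : ∀ S, S = s.2.2 ++ (s.2.1 ++ ω) ++ v →
      S.take L.length = s.2.2 ∧ S.drop L.length = s.2.1 ++ (ω ++ v) := by
    rintro S rfl
    rw [hL, ← h3]
    simp
  obtain ⟨hS1, hS2⟩ := hS _ rfl
  rw [walkPermPrefix_eq hF hR hW] at hrun
  simp only [attempt]
  have hcl : (clippedStep F R e)^[t - (i + 1)] (s.1, s.1, s.2.1 ++ (ω ++ v), s.2.2) = _ :=
    clippedStep_iterate (s := (s.1, s.2.1 ++ (ω ++ v), s.2.2)) hF hR (m := m) h1 h1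
    (by simp only [List.length_append]; omega)
  rw [hS1, hS2, ha, hcl, walkStep_iterate_append hF hR h1 (by omega), hst]
  set st := (walkStep F R e)^[t] (walkStart (c * m) z)
  have h4 : (st.2.1 ++ (ω ++ v)).take r'.length = st.2.1 := by
    rw [hr, ← (show st.2.1.length = r by omega)]; simp
  have h5 : ((st.2.1 ++ (ω ++ v)).drop r'.length).take q.length = ω := by
    rw [hr, ← (show st.2.1.length = r by omega), hq]; simp
  simp only [h4, h5]
  rw [show st.1 ++ (st.2.2 ++ st.2.1) = walkOutput st from rfl, hrun, Option.getD_some, h1, hb,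
    show (z.take (c * m), z.drop (c * m), ([] : List Bool)) = walkStart (c * m) z from rfl]
  have hie : i * e ≤ t * e := Nat.mul_le_mul_right e (by omega)
  rw [clippedStep_iterate hF hR (m := m) h1 (by simp [walkStart, hW])
    (by simp [walkStart, hW]; omega)]
  -- The edge after the first `i` steps leads to a vertex that `F` maps to vertex `i + 1`, the given
  -- one.
  have h6 : F (R ((walkStep F R e)^[i] (walkStart (c * m) z)).1
      (((walkStep F R e)^[i] (walkStart (c * m) z)).2.1.take e)).1 = s.1 := by
    rw [hs, Function.iterate_succ_apply']; rfl
  rw [if_pos h6]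
  rfl

end

end Walk

/-! ### Counting bit strings -/

/-- The bit strings of length `n`. -/
def strings (n : ℕ) : Finset (List Bool) :=
  Finset.univ.map ⟨List.Vector.toList (n := n), List.Vector.toList_injective⟩

theorem mem_strings {n : ℕ} {x : List Bool} : x ∈ strings n ↔ x.length = n := by
  simp only [strings, Finset.mem_map, Finset.mem_univ, true_and, Function.Embedding.coeFn_mk]
  exact ⟨fun ⟨v, hv⟩ => hv ▸ v.toList_length, fun h => ⟨⟨x, h⟩, rfl⟩⟩

theorem sum_strings {M : Type*} [AddCommMonoid M] (n : ℕ) (f : List Bool → M) :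
    ∑ x ∈ strings n, f x = ∑ v : List.Vector Bool n, f v.toList := by
  simp [strings]

theorem card_strings (n : ℕ) : (strings n).card = 2 ^ n := by
  simp [strings, card_vector]

theorem sum_strings_add {M : Type*} [AddCommMonoid M] (a b : ℕ) (f : List Bool → M) :
    ∑ x ∈ strings (a + b), f x = ∑ x ∈ strings a, ∑ y ∈ strings b, f (x ++ y) := by
  rw [← Finset.sum_product']
  symm
  refine Finset.sum_bij' (fun p _ => p.1 ++ p.2) (fun x _ => (x.take a, x.drop a)) ?_ ?_ ?_ ?_ ?_
  · simp only [Finset.mem_product, mem_strings, List.length_append]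
    rintro p ⟨h1, h2⟩
    rw [h1, h2]
  · simp only [Finset.mem_product, mem_strings]
    intro x hx
    simp [hx]
  · simp only [Finset.mem_product, mem_strings]
    rintro p ⟨h1, -⟩
    simp [← h1]
  · simp
  · simp

theorem card_filter_strings_add (a b : ℕ) (P : List Bool → Prop) [DecidablePred P] :
    ((strings (a + b)).filter P).card =
      ∑ x ∈ strings a, ((strings b).filter fun y => P (x ++ y)).card := by
  simp only [Finset.card_filter]
  exact sum_strings_add a b _

open Classical in
theorem invProb_eq (H : List Bool → List Bool) (n : ℕ) (G : PPT) :
    invProb H n G = (((strings n ×ˢ strings (G.coins.eval n)).filter fun p =>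
      ∃ z, G.run (H p.1) p.2 = some z ∧ z.length = n ∧ H z = H p.1).card : ℝ) /
        (2 ^ n * 2 ^ G.coins.eval n) := by
  rw [invProb]
  congr 2
  simp only [Finset.card_filter, Finset.sum_product, sum_strings, ← Finset.univ_product_univ]

theorem invProb_congr {H H' : List Bool → List Bool} {n : ℕ} (h : ∀ x, x.length = n → H x = H' x)
    (G : PPT) : invProb H n G = invProb H' n G := by
  classical
  rw [invProb_eq, invProb_eq]
  congr 3
  refine Finset.filter_congr fun p hp => ?_
  rw [Finset.mem_product, mem_strings] at hp
  rw [h _ hp.1]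
  refine exists_congr fun z => and_congr_right fun _ => and_congr_right fun hz => ?_
  rw [h _ hz]

theorem invProb_nonneg (H : List Bool → List Bool) (n : ℕ) (G : PPT) : 0 ≤ invProb H n G := by
  rw [invProb]; positivity

theorem invProb_le_one (H : List Bool → List Bool) (n : ℕ) (G : PPT) : invProb H n G ≤ 1 := by
  classical
  rw [invProb_eq]
  refine div_le_one_of_le₀ ?_ (by positivity)
  have h := Finset.card_filter_le (strings n ×ˢ strings (G.coins.eval n))
    (fun p => ∃ z, G.run (H p.1) p.2 = some z ∧ z.length = n ∧ H z = H p.1)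
  rw [Finset.card_product, card_strings, card_strings] at h
  exact_mod_cast h

open Classical in
/-- Independent trials: few strings avoid `E` in `M` consecutive blocks. -/
theorem card_avoid_blocks_le {l : ℕ} {E : Finset (List Bool)} (hE : E ⊆ strings l) {θ : ℝ}
    (hθ : θ ≤ 1) (hEθ : θ * 2 ^ l ≤ E.card) (M K : ℕ) (hK : M * l ≤ K) :
    (((strings K).filter fun C => ∀ j < M, (C.drop (j * l)).take l ∉ E).card : ℝ) ≤
      (1 - θ) ^ M * 2 ^ K := by
  induction M generalizing K with
  | zero => simp [card_strings]
  | succ M ih =>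
    obtain ⟨K', rfl⟩ : ∃ K', K = l + K' := ⟨K - l, by rw [add_mul] at hK; omega⟩
    have hK' : M * l ≤ K' := by rw [add_mul] at hK; omega
    rw [card_filter_strings_add]
    have h1 : ∀ x ∈ strings l, ((strings K').filter fun y => ∀ j < M + 1,
        ((x ++ y).drop (j * l)).take l ∉ E).card ≤ if x ∈ E then 0 else
          ((strings K').filter fun C => ∀ j < M, (C.drop (j * l)).take l ∉ E).card := by
      intro x hx
      rw [mem_strings] at hx
      have h0 : ∀ y, ((x ++ y).drop (0 * l)).take l = x := by intro y; simp [← hx]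
      split_ifs with hxE
      · rw [Nat.le_zero, Finset.card_eq_zero, Finset.filter_eq_empty_iff]
        intro y _ h
        exact h 0 (Nat.succ_pos _) (by rwa [h0])
      · refine Finset.card_le_card fun y hy => ?_
        rw [Finset.mem_filter] at hy ⊢
        refine ⟨hy.1, fun j hj => ?_⟩
        have h2 := hy.2 (j + 1) (by omega)
        rwa [List.drop_append, List.drop_of_length_le (by rw [hx, add_mul]; omega), List.nil_append,
          hx, add_mul, one_mul, Nat.add_sub_cancel] at h2
    have h2 := Finset.sum_le_sum h1
    rw [Finset.sum_ite, Finset.sum_const_zero, zero_add, Finset.sum_const, smul_eq_mul] at h2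
    have h3 : (((strings l).filter fun x => x ∉ E).card : ℝ) ≤ (1 - θ) * 2 ^ l := by
      rw [← Finset.sdiff_eq_filter, Finset.card_sdiff_of_subset hE, Nat.cast_sub
        (Finset.card_le_card hE), card_strings]
      push_cast
      linarith
    calc _ ≤ (((strings l).filter fun x => x ∉ E).card : ℝ) *
          ((strings K').filter fun C => ∀ j < M, (C.drop (j * l)).take l ∉ E).card := by
          exact_mod_cast h2
      _ ≤ ((1 - θ) * 2 ^ l) * ((1 - θ) ^ M * 2 ^ K') := by
          have := sub_nonneg.2 hθ
          exact mul_le_mul h3 (ih K' hK') (by positivity) (by positivity)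
      _ = _ := by rw [pow_succ, pow_add]; ring

/-! ### The probability that a walk avoids a set -/

section Walk

variable {F : List Bool → List Bool} {R : List Bool → List Bool → List Bool × List Bool}
  {c e m : ℕ} {α : ℝ}

/-- `F` on strings of length `n`. -/
def IsStringPermutation.onVector (hF : IsStringPermutation F) (n : ℕ) (v : List.Vector Bool n) :
    List.Vector Bool n := ⟨F v.toList, by rw [hF.length_eq, v.toList_length]⟩

theorem IsStringPermutation.onVector_bijective (hF : IsStringPermutation F) (n : ℕ) :
    (hF.onVector n).Bijective := by
  refine Finite.injective_iff_bijective.1 fun v w h => ?_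
  exact List.Vector.toList_injective (hF.injective (congrArg List.Vector.toList h))

/-- The neighbours in the graph with rotation function `R`. -/
def IsRotation.neighbor (hR : IsRotation c e R) (x : List.Vector Bool (c * m))
    (j : List.Vector Bool e) : List.Vector Bool (c * m) :=
  ⟨(R x.toList j.toList).1, (hR m _ _ x.toList_length j.toList_length).1⟩

theorem IsRotation.transitionMatrix_apply (hR : IsRotation c e R)
    (u v : List.Vector Bool (c * m)) : transitionMatrix e R (c * m) u v =
      ((Finset.univ.filter fun j => hR.neighbor u j = v).card : ℝ) / 2 ^ e := by
  rw [transitionMatrix]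
  congr 3
  refine Finset.filter_congr fun j _ => ?_
  exact List.Vector.toList_injective.eq_iff (a := hR.neighbor u j) (b := v)

theorem IsRotation.mulVec_eq (hR : IsRotation c e R) (f : List.Vector Bool (c * m) → ℝ)
    (u : List.Vector Bool (c * m)) : (transitionMatrix e R (c * m)).mulVec f u =
      (∑ j, f (hR.neighbor u j)) / 2 ^ e := by
  simp only [Matrix.mulVec, dotProduct, hR.transitionMatrix_apply]
  rw [Finset.sum_div, ← Finset.sum_fiberwise Finset.univ (hR.neighbor u)]
  refine Finset.sum_congr rfl fun v _ => ?_
  rw [Finset.sum_congr rfl fun j hj => by rw [(Finset.mem_filter.1 hj).2], Finset.sum_const,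
    nsmul_eq_mul]
  ring

theorem IsRotation.sum_transitionMatrix (hR : IsRotation c e R) (u : List.Vector Bool (c * m)) :
    ∑ v, transitionMatrix e R (c * m) u v = 1 := by
  have h := hR.mulVec_eq (fun _ => 1) u
  simpa [Matrix.mulVec, dotProduct, card_vector] using h

/-- The rotation function maps the edges from `u` to `v` injectively to the edges from `v` to `u`,
and conversely. -/
theorem IsRotation.isSymm (hR : IsRotation c e R) : (transitionMatrix e R (c * m)).IsSymm := by
  have key : ∀ u v : List.Vector Bool (c * m),
      (Finset.univ.filter fun j => hR.neighbor u j = v).card ≤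
        (Finset.univ.filter fun j => hR.neighbor v j = u).card := by
    intro u v
    refine Finset.card_le_card_of_injOn
      (fun j => ⟨(R u.toList j.toList).2, (hR m _ _ u.toList_length j.toList_length).2.1⟩) ?_ ?_
    · intro j hj
      simp only [Finset.coe_filter, Finset.mem_univ, true_and, Set.mem_ofPred_eq] at hj ⊢
      subst hj
      refine List.Vector.toList_injective ?_
      exact congrArg Prod.fst (hR m _ _ u.toList_length j.toList_length).2.2
    · intro j hj j' hj' h
      simp only [Finset.coe_filter, Finset.mem_univ, true_and, Set.mem_ofPred_eq] at hj hj'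
      have h1 := (hR m _ _ u.toList_length j.toList_length).2.2
      have h2 := (hR m _ _ u.toList_length j'.toList_length).2.2
      have h3 : (R u.toList j.toList).1 = (R u.toList j'.toList).1 :=
        congrArg List.Vector.toList (hj.trans hj'.symm)
      have h4 : (R u.toList j.toList).2 = (R u.toList j'.toList).2 :=
        congrArg List.Vector.toList h
      rw [h3, h4, h2] at h1
      exact List.Vector.toList_injective (congrArg Prod.snd h1).symm
  refine Matrix.IsSymm.ext fun u v => ?_
  rw [hR.transitionMatrix_apply, hR.transitionMatrix_apply, le_antisymm (key u v) (key v u)]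

open Classical in
-- The first `e` bits of a uniform string are a uniform colour, so reading them is one step of the
-- chain behind `stayProb`. The collected colours `acc` change at each step and are therefore
-- arbitrary in the induction.
theorem card_stay_le (hF : IsStringPermutation F) (hR : IsRotation c e R) (B : Finset (List Bool))
    (r t : ℕ) (x : List.Vector Bool (c * m)) (acc : List Bool) :
    (((strings (t * e + r)).filter fun w => ∀ i < t,
        ((walkStep F R e)^[i + 1] (x.toList, w, acc)).1 ∉ B).card : ℝ) ≤
      stayProb (transitionMatrix e R (c * m)) (hF.onVector (c * m))
        (Finset.univ.filter fun v => v.toList ∉ B) t x * 2 ^ (t * e + r) := by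
  induction t generalizing x acc with
  | zero => simp [stayProb, card_strings]
  | succ t ih =>
    rw [show (t + 1) * e + r = e + (t * e + r) by ring, card_filter_strings_add, sum_strings,
      stayProb, hR.mulVec_eq, pow_add, ← mul_assoc, div_mul_cancel₀ _ (by positivity),
      Finset.sum_mul]
    push_cast
    refine Finset.sum_le_sum fun j _ => ?_
    have hstep : ∀ w, walkStep F R e (x.toList, j.toList ++ w, acc) =
        ((hF.onVector (c * m) (hR.neighbor x j)).toList, w,
          (R x.toList j.toList).2 ++ acc) := by
      intro w
      have : (j.toList ++ w).take e = j.toList := by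
        rw [List.take_append_of_le_length (by simp), List.take_of_length_le (by simp)]
      have h2 : (j.toList ++ w).drop e = w := by
        rw [List.drop_append, List.drop_of_length_le (by simp)]; simp
      simp only [walkStep, this, h2]
      rfl
    simp only [Finset.mem_filter, Finset.mem_univ, true_and]
    split_ifs with hB
    · rw [zero_mul, Finset.filter_eq_empty_iff.2, Finset.card_empty, Nat.cast_zero]
      intro w _ h
      have := h 0 (by omega)
      rw [zero_add, Function.iterate_one, hstep] at this
      exact this hB
    · refine le_trans ?_ (ih _ ((R x.toList j.toList).2 ++ acc))
      refine Nat.cast_le.2 (Finset.card_le_card fun w hw => ?_)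
      rw [Finset.mem_filter] at hw ⊢
      refine ⟨hw.1, fun i hi => ?_⟩
      have := hw.2 (i + 1) (by omega)
      rwa [Function.iterate_succ_apply, hstep] at this

open Classical in
-- Averages `card_stay_le` over the start and bounds the average by `sum_stayProb_le` for the
-- complement of `B`: if `μ` is the density of `B`, then `(1 - α) (1 - μ) + α = 1 - (1 - α) μ`.
theorem card_avoid_le (hF : IsStringPermutation F) (hR : IsRotation c e R)
    (hα : SecondEigenvalueLE (transitionMatrix e R (c * m)) α) (h0 : 0 ≤ α) (h1 : α ≤ 1)
    {B : Finset (List Bool)} (hB : B ⊆ strings (c * m)) (t r : ℕ) :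
    (((strings (c * m + (t * e + r))).filter fun W => ∀ i < t,
        ((walkStep F R e)^[i + 1] (walkStart (c * m) W)).1 ∉ B).card : ℝ) ≤
      (1 - (1 - α) * (B.card / 2 ^ (c * m))) ^ t * 2 ^ (c * m + (t * e + r)) := by
  rw [card_filter_strings_add, sum_strings]
  have hstart : ∀ (x : List.Vector Bool (c * m)) w,
      walkStart (c * m) (x.toList ++ w) = (x.toList, w, []) := by
    intro x w
    rw [walkStart, List.take_append_of_le_length (by simp), List.take_of_length_le (by simp),
      List.drop_append, List.drop_of_length_le (by simp)]
    simp
  simp only [hstart]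
  push_cast
  refine (Finset.sum_le_sum fun x _ => card_stay_le hF hR B r t x []).trans ?_
  rw [← Finset.sum_mul, pow_add (2 : ℝ) (c * m), ← mul_assoc]
  refine mul_le_mul_of_nonneg_right ?_ (by positivity)
  have h := hα.sum_stayProb_le hR.isSymm hR.sum_transitionMatrix h0 h1
    (hF.onVector_bijective (c * m)) (Finset.univ.filter fun v => v.toList ∉ B) t
  have hcard : ((Finset.univ.filter fun v : List.Vector Bool (c * m) => v.toList ∉ B).card : ℝ) =
      2 ^ (c * m) - B.card := by
    rw [eq_sub_iff_add_eq, ← Nat.cast_add]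
    have h2 : (Finset.univ.filter fun v : List.Vector Bool (c * m) => v.toList ∈ B).card =
        B.card := by
      rw [← Finset.card_map ⟨List.Vector.toList (n := c * m), List.Vector.toList_injective⟩]
      congr 1
      ext x
      simp only [Finset.mem_map, Finset.mem_filter, Finset.mem_univ, true_and,
        Function.Embedding.coeFn_mk]
      exact ⟨fun ⟨v, hv, h⟩ => h ▸ hv, fun h => ⟨⟨x, mem_strings.1 (hB h)⟩, h, rfl⟩⟩
    rw [← h2, add_comm, Finset.card_filter_add_card_filter_not]
    simp [card_vector]
  rw [hcard] at h
  simp only [card_vector, Fintype.card_bool, Nat.cast_pow, Nat.cast_ofNat] at h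
  have h3 : (1 - α) * ((2 ^ (c * m) - (B.card : ℝ)) / 2 ^ (c * m)) + α =
      1 - (1 - α) * (B.card / 2 ^ (c * m)) := by
    field_simp
    ring
  rwa [h3] at h

end Walk

/-! ### The reduction -/

section Reduction

variable {F : List Bool → List Bool} {R : List Bool → List Bool → List Bool × List Bool}
  {c e m : ℕ} {α : ℝ}

open Classical in
/-- The pairs of a walk (with a tail of `r` bits) and a string of coins with which `G'` inverts the
walk. -/
noncomputable def invertedWalks (F : List Bool → List Bool)
    (R : List Bool → List Bool → List Bool × List Bool) (e n t r : ℕ) (G' : PPT) :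
    Finset (List Bool × List Bool) :=
  (strings (n + (t * e + r)) ×ˢ strings (G'.coins.eval (n + (t * e + r)))).filter fun p =>
    ∃ z, G'.run (walkPermPrefix F R e n t p.1) p.2 = some z ∧ z.length = n + (t * e + r) ∧
      walkPermPrefix F R e n t z = walkPermPrefix F R e n t p.1

/-- The walks in `invertedWalks` whose vertex number `i + 1` is `y`, as inputs of `attempt`. -/
noncomputable def successStrings (F : List Bool → List Bool)
    (R : List Bool → List Bool → List Bool × List Bool) (e n t r : ℕ) (G' : PPT) (i : ℕ)
    (y : List Bool) : Finset (List Bool) :=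
  ((invertedWalks F R e n t r G').filter fun p =>
    ((walkStep F R e)^[i + 1] (walkStart n p.1)).1 = y).image fun p =>
      ((walkStep F R e)^[i + 1] (walkStart n p.1)).2.2 ++
        (((walkStep F R e)^[i + 1] (walkStart n p.1)).2.1 ++ p.2)

open Classical in
/-- The vertices that are hard to invert at every position of the walk. -/
noncomputable def hardVertices (F : List Bool → List Bool)
    (R : List Bool → List Bool → List Bool × List Bool) (e n t r : ℕ) (G' : PPT) (θ : ℝ) :
    Finset (List Bool) :=
  (strings n).filter fun y => ∀ i < t, ((successStrings F R e n t r G' i y).card : ℝ) ≤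
    θ * 2 ^ (t * e + r + G'.coins.eval (n + (t * e + r)))

theorem mem_invertedWalks {n t r : ℕ} {G' : PPT} {p : List Bool × List Bool}
    (hp : p ∈ invertedWalks F R e n t r G') :
    p.1.length = n + (t * e + r) ∧ p.2.length = G'.coins.eval (n + (t * e + r)) ∧
    ∃ z, G'.run (walkPermPrefix F R e n t p.1) p.2 = some z ∧ z.length = n + (t * e + r) ∧
      walkPermPrefix F R e n t z = walkPermPrefix F R e n t p.1 := by
  simpa only [invertedWalks, Finset.mem_filter, Finset.mem_product, mem_strings, and_assoc] using hp

theorem successStrings_subset (hF : IsStringPermutation F) (hR : IsRotation c e R) {t r i : ℕ}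
    (hi : i < t) (G' : PPT) (y : List Bool) : successStrings F R e (c * m) t r G' i y ⊆
      strings (t * e + r + G'.coins.eval (c * m + (t * e + r))) := by
  intro S hS
  simp only [successStrings, Finset.mem_image, Finset.mem_filter] at hS
  obtain ⟨p, ⟨hp, -⟩, rfl⟩ := hS
  obtain ⟨h1, h2, -⟩ := mem_invertedWalks hp
  have hie : (i + 1) * e ≤ t * e := Nat.mul_le_mul_right e (by omega)
  obtain ⟨-, h3, h4⟩ := length_walkStart hF hR (k := i + 1) h1 (by omega)
  rw [mem_strings, List.length_append, List.length_append]
  omega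

/-- A walk is determined by its vertex `i + 1`, the colours back from there and the colours still
unread, because steps are reversible. Hence the image in `successStrings` loses nothing. -/
theorem card_filter_invertedWalks_le (hF : IsStringPermutation F) (hR : IsRotation c e R)
    {t r i : ℕ} (hi : i < t) (G' : PPT) (y : List Bool) :
    ((invertedWalks F R e (c * m) t r G').filter fun p =>
      ((walkStep F R e)^[i + 1] (walkStart (c * m) p.1)).1 = y).card ≤
        (successStrings F R e (c * m) t r G' i y).card := by
  have hie : (i + 1) * e ≤ t * e := Nat.mul_le_mul_right e (by omega)
  rw [successStrings, Finset.card_image_of_injOn]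
  intro p hp p' hp' h
  simp only [Finset.coe_filter, Set.mem_ofPred_eq] at hp hp'
  obtain ⟨h1, -, -⟩ := mem_invertedWalks hp.1
  obtain ⟨h1', -, -⟩ := mem_invertedWalks hp'.1
  obtain ⟨-, h3, h4⟩ := length_walkStart hF hR (k := i + 1) h1 (by omega)
  obtain ⟨-, h3', h4'⟩ := length_walkStart hF hR (k := i + 1) h1' (by omega)
  obtain ⟨ha, hb⟩ := List.append_inj h (h4.trans h4'.symm)
  obtain ⟨hb, hc⟩ := List.append_inj hb (h3.trans h3'.symm)
  exact Prod.ext (walkStart_iterate_injective hF hR h1 h1' (by omega)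
    (Prod.ext (hp.2.trans hp'.2.symm) (Prod.ext hb ha))) hc

/-- The inverted walks that avoid the hard vertices are few by the expander bound. The others have a
hard vertex `y` at some position `i + 1`; for each of the `t` positions and at most `2 ^ (c * m)`
vertices, hardness bounds their number, which adds up to a proportion of at most `t * θ`. -/
theorem invProb_walkPermPrefix_le (hF : IsStringPermutation F) (hR : IsRotation c e R)
    (hα : SecondEigenvalueLE (transitionMatrix e R (c * m)) α) (h0 : 0 ≤ α) (h1 : α ≤ 1)
    (G' : PPT) (t r : ℕ) {θ : ℝ} (hθ : 0 ≤ θ) :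
    invProb (walkPermPrefix F R e (c * m) t) (c * m + (t * e + r)) G' ≤
      (1 - (1 - α) * ((hardVertices F R e (c * m) t r G' θ).card / 2 ^ (c * m))) ^ t + t * θ := by
  classical
  set B := hardVertices F R e (c * m) t r G' θ with hB
  set q := G'.coins.eval (c * m + (t * e + r)) with hq
  have hBs : B ⊆ strings (c * m) := Finset.filter_subset _ _
  have hcover : invertedWalks F R e (c * m) t r G' ⊆
      (((strings (c * m + (t * e + r))).filter fun W => ∀ i < t,
        ((walkStep F R e)^[i + 1] (walkStart (c * m) W)).1 ∉ B) ×ˢ strings q) ∪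
      (Finset.range t).biUnion fun i => B.biUnion fun y =>
        (invertedWalks F R e (c * m) t r G').filter fun p =>
          ((walkStep F R e)^[i + 1] (walkStart (c * m) p.1)).1 = y := by
    intro p hp
    obtain ⟨h1, h2, -⟩ := mem_invertedWalks hp
    by_cases h : ∀ i < t, ((walkStep F R e)^[i + 1] (walkStart (c * m) p.1)).1 ∉ B
    · refine Finset.mem_union_left _ ?_
      simp only [Finset.mem_product, Finset.mem_filter, mem_strings]
      exact ⟨⟨h1, h⟩, h2⟩
    · refine Finset.mem_union_right _ ?_
      push Not at h
      obtain ⟨i, hi, h⟩ := h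
      simp only [Finset.mem_biUnion, Finset.mem_range, Finset.mem_filter]
      exact ⟨i, hi, _, h, hp, rfl⟩
  have hfib : ∀ i ∈ Finset.range t, ∀ y ∈ B,
      ((((invertedWalks F R e (c * m) t r G').filter fun p =>
          ((walkStep F R e)^[i + 1] (walkStart (c * m) p.1)).1 = y).card : ℕ) : ℝ) ≤
        θ * 2 ^ (t * e + r + q) := by
    intro i hi y hy
    rw [Finset.mem_range] at hi
    refine le_trans ?_ ((Finset.mem_filter.1 hy).2 i hi)
    exact_mod_cast card_filter_invertedWalks_le hF hR hi G' y
  have hBcard : (B.card : ℝ) ≤ 2 ^ (c * m) := by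
    have := Finset.card_le_card hBs
    rw [card_strings] at this
    exact_mod_cast this
  have hcard : ((invertedWalks F R e (c * m) t r G').card : ℝ) ≤
      (1 - (1 - α) * (B.card / 2 ^ (c * m))) ^ t * 2 ^ (c * m + (t * e + r)) * 2 ^ q +
        t * (2 ^ (c * m) * (θ * 2 ^ (t * e + r + q))) := by
    refine (Nat.cast_le.2 ((Finset.card_le_card hcover).trans (Finset.card_union_le _ _))).trans ?_
    rw [Finset.card_product, card_strings]
    push_cast
    refine add_le_add (mul_le_mul_of_nonneg_right (card_avoid_le hF hR hα h0 h1 hBs t r)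
      (by positivity)) ?_
    refine (Nat.cast_le.2 Finset.card_biUnion_le).trans ?_
    push_cast
    have hi : ∀ i ∈ Finset.range t, (((B.biUnion fun y =>
        (invertedWalks F R e (c * m) t r G').filter fun p =>
          ((walkStep F R e)^[i + 1] (walkStart (c * m) p.1)).1 = y).card : ℕ) : ℝ) ≤
        2 ^ (c * m) * (θ * 2 ^ (t * e + r + q)) := by
      intro i hi
      refine (Nat.cast_le.2 Finset.card_biUnion_le).trans ?_
      push_cast
      refine (Finset.sum_le_sum (hfib i hi)).trans ?_
      rw [Finset.sum_const, nsmul_eq_mul]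
      gcongr
    refine (Finset.sum_le_sum hi).trans ?_
    rw [Finset.sum_const, nsmul_eq_mul, Finset.card_range]
  rw [invProb_eq, div_le_iff₀ (by positivity)]
  refine le_trans (le_of_eq ?_) (hcard.trans (le_of_eq ?_))
  · rw [invertedWalks]
  · rw [pow_add (2 : ℝ) (c * m), pow_add (2 : ℝ) (t * e + r) q]
    ring

/-- Failure on a hard vertex is conceded. For any other vertex a single position `i` has success
probability at least `θ`, and the `M` consecutive blocks of the coin string are independent trials
for it. The hypotheses `hl` and `ht` make the coin string long enough for its suffixes to represent
all parameters. -/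
theorem one_sub_invProb_le (hF : IsStringPermutation F) (hR : IsRotation c e R) {G' G : PPT}
    (hG : ∀ y C, G.run y C = inverter F R e G'.run (y, C)) {t r M : ℕ} {θ : ℝ} (h1 : θ ≤ 1)
    (hM : M * (t * e + r + G'.coins.eval (c * m + (t * e + r))) ≤ G.coins.eval (c * m))
    (hl : t * e + r + G'.coins.eval (c * m + (t * e + r)) ≤ G.coins.eval (c * m))
    (ht : t ≤ G.coins.eval (c * m)) :
    1 - invProb F (c * m) G ≤
      (hardVertices F R e (c * m) t r G' θ).card / 2 ^ (c * m) + (1 - θ) ^ M := by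
  classical
  set B := hardVertices F R e (c * m) t r G' θ with hB
  set l := t * e + r + G'.coins.eval (c * m + (t * e + r)) with hl_def
  set K := G.coins.eval (c * m) with hK
  have hBs : B ⊆ strings (c * m) := Finset.filter_subset _ _
  have hfail : ∀ y ∈ strings (c * m), (((strings K).filter fun C =>
      ¬ (inverter F R e G'.run (y, C)).isSome).card : ℝ) ≤
        (if y ∈ B then 2 ^ K else 0) + (1 - θ) ^ M * 2 ^ K := by
    intro y hy
    split_ifs with hyB
    · have h2 : (0 : ℝ) ≤ (1 - θ) ^ M * 2 ^ K := by
        have := sub_nonneg.2 h1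
        positivity
      have h3 := Finset.card_filter_le (strings K) fun C =>
        ¬ (inverter F R e G'.run (y, C)).isSome
      rw [card_strings] at h3
      have h4 : (((strings K).filter fun C =>
        ¬ (inverter F R e G'.run (y, C)).isSome).card : ℝ) ≤ 2 ^ K := by exact_mod_cast h3
      linarith
    · rw [zero_add]
      have hex : ∃ i < t, θ * 2 ^ l ≤ ((successStrings F R e (c * m) t r G' i y).card : ℝ) := by
        by_contra hno
        push Not at hno
        exact hyB (Finset.mem_filter.2 ⟨hy, fun i hi => (hno i hi).le⟩)
      obtain ⟨i, hi, hcard⟩ := hex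
      refine le_trans ?_ (card_avoid_blocks_le (successStrings_subset hF hR hi G' y) h1 hcard M K hM)
      refine Nat.cast_le.2 (Finset.card_le_card fun C hC => ?_)
      rw [Finset.mem_filter] at hC ⊢
      refine ⟨hC.1, fun j hj hmem => hC.2 ?_⟩
      have hClen := mem_strings.1 hC.1
      -- Every number up to `K` is the length of a suffix of the coin string.
      have hsuf : ∀ k ≤ K, (C.drop (K - k)).length = k ∧ C.drop (K - k) <:+ C := by
        intro k hk
        exact ⟨by rw [List.length_drop]; omega, List.drop_suffix _ _⟩
      simp only [successStrings, Finset.mem_image, Finset.mem_filter] at hmem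
      obtain ⟨p, ⟨hp, hpy⟩, hpS⟩ := hmem
      obtain ⟨hp1, hp2, z, hz1, hz2, hz3⟩ := mem_invertedWalks hp
      have hie : (i + 1) * e ≤ t * e := Nat.mul_le_mul_right e (by omega)
      obtain ⟨ha, ha'⟩ := hsuf (t - (i + 1)) (by omega)
      obtain ⟨hL, hL'⟩ := hsuf ((i + 1) * e) (by omega)
      obtain ⟨hr, hr'⟩ := hsuf r (by omega)
      obtain ⟨hq, hq'⟩ := hsuf p.2.length (by omega)
      obtain ⟨hb, hb'⟩ := hsuf i (by omega)
      refine inverter_isSome ha' hL' hr' hq' hb' (List.drop_suffix (j * l) C) ?_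
      have h := attempt_isSome hF hR (v := (C.drop (j * l)).drop l) hp1 hz1 (hz2.trans hp1.symm) hz3
        hi ha hL hr hq hb
      rwa [hpS, hpy, List.take_append_drop] at h
  -- As `F` permutes the strings, `F x` is uniform when `x` is.
  have hsum : ∑ y ∈ strings (c * m), (((strings K).filter fun C =>
      ¬ (inverter F R e G'.run (y, C)).isSome).card : ℝ) =
      ∑ x ∈ strings (c * m), (((strings K).filter fun C =>
      ¬ (inverter F R e G'.run (F x, C)).isSome).card : ℝ) := by
    rw [sum_strings, sum_strings]
    exact ((Equiv.ofBijective _ (hF.onVector_bijective (c * m))).sum_comp fun v =>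
      (((strings K).filter fun C => ¬ (inverter F R e G'.run (v.toList, C)).isSome).card : ℝ)).symm
  have hle := Finset.sum_le_sum hfail
  rw [hsum, Finset.sum_add_distrib, Finset.sum_const, card_strings, ← Finset.sum_filter,
    Finset.filter_mem_eq_inter, Finset.inter_eq_right.2 hBs, Finset.sum_const, nsmul_eq_mul,
    nsmul_eq_mul] at hle
  have hsucc : (2 : ℝ) ^ (c * m) * 2 ^ K - ∑ x ∈ strings (c * m), (((strings K).filter fun C =>
      ¬ (inverter F R e G'.run (F x, C)).isSome).card : ℝ) ≤
      ((strings (c * m) ×ˢ strings K).filter fun p => ∃ z, G.run (F p.1) p.2 = some z ∧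
        z.length = c * m ∧ F z = F p.1).card := by
    rw [sub_le_iff_le_add', ← Nat.cast_sum]
    have hall : 2 ^ (c * m) * 2 ^ K = (strings (c * m) ×ˢ strings K).card := by
      rw [Finset.card_product, card_strings, card_strings]
    have hsplit := Finset.card_filter_add_card_filter_not (s := strings (c * m) ×ˢ strings K)
      fun p => ¬ (inverter F R e G'.run (F p.1, p.2)).isSome
    have h2 : ∑ x ∈ strings (c * m), ((strings K).filter fun C =>
        ¬ (inverter F R e G'.run (F x, C)).isSome).card =
        ((strings (c * m) ×ˢ strings K).filter fun p =>
          ¬ (inverter F R e G'.run (F p.1, p.2)).isSome).card := by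
      simp only [Finset.card_filter, Finset.sum_product]
    rw [h2]
    have h3 : ((strings (c * m) ×ˢ strings K).filter fun p =>
        ¬ ¬ (inverter F R e G'.run (F p.1, p.2)).isSome).card ≤
        ((strings (c * m) ×ˢ strings K).filter fun p => ∃ z, G.run (F p.1) p.2 = some z ∧
        z.length = c * m ∧ F z = F p.1).card := by
      refine Finset.card_le_card fun p hp => ?_
      rw [Finset.mem_filter] at hp ⊢
      obtain ⟨z, hz⟩ := Option.isSome_iff_exists.1 (not_not.1 hp.2)
      have hz' := eq_of_inverter_eq_some hz
      refine ⟨hp.1, z, by rw [hG, hz], ?_, hz'⟩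
      rw [Finset.mem_product, mem_strings] at hp
      rw [← hF.length_eq, hz', hF.length_eq, hp.1.1]
    have h4 := hsplit.symm.le.trans (Nat.add_le_add_left h3 _)
    rw [← hall] at h4
    exact_mod_cast h4
  rw [invProb_eq, ← hK, sub_le_iff_le_add', ← sub_le_iff_le_add, le_div_iff₀ (by positivity)]
  refine le_trans ?_ hsucc
  rw [sub_mul, one_mul]
  refine sub_le_sub_left (hle.trans (le_of_eq ?_)) _
  push_cast
  field_simp

end Reduction

/-! ### Asymptotics -/

section Asymptotics

open Filter

theorem Polynomial.exists_eval_le_pow (p : Polynomial ℕ) :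
    ∃ C d : ℕ, ∀ n, p.eval n ≤ C * (n + 1) ^ d := by
  refine ⟨∑ i ∈ Finset.range (p.natDegree + 1), p.coeff i, p.natDegree, fun n => ?_⟩
  rw [Polynomial.eval_eq_sum_range, Finset.sum_mul]
  refine Finset.sum_le_sum fun i hi => Nat.mul_le_mul_left _ ?_
  rw [Finset.mem_range] at hi
  exact (Nat.pow_le_pow_left (Nat.le_succ n) i).trans
    (Nat.pow_le_pow_right (Nat.succ_pos n) (by omega))

theorem Significant.exists_nat {p : ℕ → ℝ} (hp : Significant p) :
    ∃ a : ℕ, ∀ᶠ n : ℕ in atTop, 1 ≤ ((n : ℝ) + 1) ^ a * p n := by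
  obtain ⟨k, hk, h⟩ := hp
  refine ⟨⌈k⌉₊, ?_⟩
  filter_upwards [h, eventually_ge_atTop 1] with n hn h1
  have hn0 : (0 : ℝ) < n := by exact_mod_cast h1
  have h2 : (n : ℝ) ^ k ≤ ((n : ℝ) + 1) ^ ⌈k⌉₊ := by
    rw [← Real.rpow_natCast]
    exact (Real.rpow_le_rpow hn0.le (by linarith) hk.le).trans
      (Real.rpow_le_rpow_of_exponent_le (by linarith) (Nat.le_ceil k))
  have h3 : (1 : ℝ) = (n : ℝ) ^ k * (n : ℝ) ^ (-k) := by
    rw [← Real.rpow_add hn0, add_neg_cancel, Real.rpow_zero]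
  exact h3.le.trans (mul_le_mul h2 hn (by positivity) (by positivity))

theorem eventually_const_le_succ (C : ℝ) : ∀ᶠ n : ℕ in atTop, C ≤ (n : ℝ) + 1 := by
  filter_upwards [tendsto_natCast_atTop_atTop.eventually_ge_atTop C] with n hn
  linarith

theorem eventually_exp_neg_le (a : ℕ) :
    ∀ᶠ n : ℕ in atTop, ((n : ℝ) + 1) ^ a * Real.exp (-((n : ℝ) + 1)) ≤ 1 / 4 := by
  have h := (Real.tendsto_pow_mul_exp_neg_atTop_nhds_zero a).comp
    ((tendsto_natCast_atTop_atTop (R := ℝ)).atTop_add (tendsto_const_nhds (x := (1 : ℝ))))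
  exact h.eventually (eventually_le_nhds (by norm_num))

/-- If the power is at most `ε / 2`, the sum is at most `ε`. Otherwise `s` is less than `x / 4`
times the power, and one factor absorbs it, since `(1 - 3x/4) + x/4 = 1 - x/2`; this is where `t ≠
0` enters. -/
theorem pow_add_le_max {x ε s : ℝ} {t : ℕ} (hx : 0 < x) (hx1 : x ≤ 1) (hε : 0 < ε) (ht : t ≠ 0)
    (hs : s ≤ ε * x / 8) : (1 - x * (3 / 4)) ^ t + s ≤ max ((1 - x / 2) ^ t) ε := by
  obtain ⟨t, rfl⟩ : ∃ s, t = s + 1 := ⟨t - 1, by omega⟩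
  have ha : 0 ≤ 1 - x * (3 / 4) := by linarith
  rcases le_or_gt ((1 - x * (3 / 4)) ^ (t + 1)) (ε / 2) with h | h
  · refine le_max_of_le_right ?_
    nlinarith
  · refine le_max_of_le_left ?_
    have h1 : (1 - x * (3 / 4)) ^ t ≤ (1 - x / 2) ^ t := pow_le_pow_left₀ ha (by linarith) t
    have h2 : (1 - x * (3 / 4)) ^ (t + 1) ≤ (1 - x * (3 / 4)) ^ t :=
      pow_le_pow_of_le_one ha (by linarith) (Nat.le_succ t)
    calc (1 - x * (3 / 4)) ^ (t + 1) + s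
        ≤ (1 - x * (3 / 4)) ^ (t + 1) + x / 4 * (1 - x * (3 / 4)) ^ t := by nlinarith
      _ = (1 - x / 2) * (1 - x * (3 / 4)) ^ t := by ring
      _ ≤ (1 - x / 2) * (1 - x / 2) ^ t := by
          refine mul_le_mul_of_nonneg_left h1 (by linarith)
      _ = _ := by ring

theorem one_sub_pow_le_exp {x : ℝ} (hx : x ≤ 1) (t : ℕ) : (1 - x) ^ t ≤ Real.exp (-(x * t)) := by
  calc (1 - x) ^ t ≤ Real.exp (-x) ^ t :=
        pow_le_pow_left₀ (by linarith) (Real.one_sub_le_exp_neg x) t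
    _ = _ := by rw [← Real.exp_nat_mul]; ring_nf

/-- The two bounds meet at `d = 1/4`. There `exp (7/8) ≥ 2` is needed, for which the linear bound `1
+ 7/8` is too small; hence the quadratic one. -/
theorem exp_neg_le_max {d : ℝ} (hd : 0 ≤ d) : Real.exp (-(7 / 2 * d)) ≤ max (1 - 2 * d) (1 / 2) := by
  have h := Real.quadratic_le_exp_of_nonneg (x := 7 / 2 * d) (by linarith)
  have hpos : 0 < 1 + 7 / 2 * d + (7 / 2 * d) ^ 2 / 2 := by positivity
  have h2 : Real.exp (-(7 / 2 * d)) ≤ (1 + 7 / 2 * d + (7 / 2 * d) ^ 2 / 2)⁻¹ := by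
    rw [Real.exp_neg]
    exact inv_anti₀ hpos h
  refine h2.trans ?_
  rcases le_or_gt d (1 / 4) with h3 | h3
  · refine le_max_of_le_left ?_
    rw [inv_le_iff_one_le_mul₀ hpos]
    nlinarith [mul_nonneg hd (mul_nonneg hd (sub_nonneg.2 h3)), mul_nonneg hd (sub_nonneg.2 h3)]
  · refine le_max_of_le_right ?_
    rw [inv_le_iff_one_le_mul₀ hpos]
    nlinarith

end Asymptotics

/-! ### The choice of parameters, and the theorem. -/

section Main

open Filter

variable {F : List Bool → List Bool} {R : List Bool → List Bool → List Bool × List Bool}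
  {c e : ℕ} {α : ℝ}

theorem IsFullyExplicitExpander.nonneg (hR : IsFullyExplicitExpander c e α R) (hc : 0 < c) :
    0 ≤ α := by
  -- The graph for `m = 1` has at least two vertices because `0 < c`.
  refine (hR.2.2 1).nonneg hR.1.isSymm hR.1.sum_transitionMatrix ?_
  rw [card_vector, Fintype.card_bool]
  exact Nat.one_lt_two_pow (by omega)

/-- The p.p.t. function that uses `G'`, an inverter of walks, to invert `F`. -/
def inverterPPT (F : List Bool → List Bool) (R : List Bool → List Bool → List Bool × List Bool)
    (e : ℕ) (hF : PolyTime F) (hR : PolyTime (fun p : List Bool × List Bool => R p.1 p.2))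
    (G' : PPT) (coins : Polynomial ℕ) : PPT where
  run y C := inverter F R e G'.run (y, C)
  coins := coins
  polyTime := PolyTime.inverter hF hR G'.polyTime

theorem tendsto_const_mul_nat (hc : 0 < c) : Tendsto (fun m : ℕ => c * m) atTop atTop :=
  tendsto_atTop_mono (fun m => Nat.le_mul_of_pos_left m hc) tendsto_id

/-- Take `θ = (n + 1) ^ (-k)` and `M = (n + 1) ^ (k + 1)` trials: then `(1 - θ) ^ M ≤ exp (-(n + 1))
≤ δ / 4`, so the hard vertices have density at least `3δ/4`. The inverter depends on `p` but not on
`t` and `r`, so a single threshold for `m` serves all of them. -/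
theorem eventually_invProb_walkPermPrefix_le (hc : 0 < c) (hα : α < 1)
    (hR : IsFullyExplicitExpander c e α R) (hFp : PolyTime F) (hF : IsStringPermutation F)
    {δ : ℕ → ℝ} (hδ : Significant δ)
    (hinv : ∀ G : PPT, ∀ᶠ n : ℕ in atTop, invProb F n G ≤ 1 - δ n) (p : Polynomial ℕ) (G' : PPT)
    {ε : ℕ → ℝ} (hε : Significant ε) :
    ∀ᶠ m : ℕ in atTop, 0 < δ (c * m) ∧ δ (c * m) ≤ 1 ∧
      ∀ t r : ℕ, t ≤ p.eval (c * m) → r ≤ p.eval (c * m) →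
      invProb (walkPermPrefix F R e (c * m) t) (c * m + (t * e + r)) G' ≤
        max ((1 - (1 - α) * δ (c * m) / 2) ^ t) (ε (c * m)) := by
  have h0 := hR.nonneg hc
  obtain ⟨a, ha⟩ := hδ.exists_nat
  obtain ⟨b, hb⟩ := hε.exists_nat
  obtain ⟨C, d, hp⟩ := p.exists_eval_le_pow
  -- The exponents `d`, `a` and `b` pay for `t`, `1 / δ` and `1 / ε`, and the additional `1` for the
  -- constant `8C / (1 - α)`; this gives `tθ ≤ ε (1 - α) δ / 8`.
  set k := d + a + b + 1 with hk
  -- Bounds the length of a block, and `t` itself, for all admissible `t` and `r`.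
  set L : Polynomial ℕ := p * (e : Polynomial ℕ) + p + p +
    G'.coins.comp (Polynomial.X + (p * (e : Polynomial ℕ) + p)) with hL
  set G := inverterPPT F R e hFp hR.2.1 G' ((Polynomial.X + 1) ^ (k + 1) * L) with hG
  have hn : ∀ᶠ n : ℕ in atTop, invProb F n G ≤ 1 - δ n ∧
      1 ≤ ((n : ℝ) + 1) ^ a * δ n ∧ 1 ≤ ((n : ℝ) + 1) ^ b * ε n ∧
      C * 8 / (1 - α) ≤ (n : ℝ) + 1 ∧
      ((n : ℝ) + 1) ^ a * Real.exp (-((n : ℝ) + 1)) ≤ 1 / 4 := by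
    filter_upwards [hinv G, ha, hb, eventually_const_le_succ (C * 8 / (1 - α)),
      eventually_exp_neg_le a] with n h1 h2 h3 h4 h5
    exact ⟨h1, h2, h3, h4, h5⟩
  filter_upwards [(tendsto_const_mul_nat hc).eventually hn] with m hm
  set n := c * m with hn_def
  obtain ⟨h1, h2, h3, h4, h5⟩ := hm
  have hn1 : (0 : ℝ) < (n : ℝ) + 1 := by positivity
  have hδ0 : 0 < δ n := by
    by_contra h
    have := mul_nonpos_of_nonneg_of_nonpos (pow_nonneg hn1.le a) (not_lt.1 h)
    linarith
  have hε0 : 0 < ε n := by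
    by_contra h
    have := mul_nonpos_of_nonneg_of_nonpos (pow_nonneg hn1.le b) (not_lt.1 h)
    linarith
  have hδ1 : δ n ≤ 1 := by linarith [invProb_nonneg F n G]
  refine ⟨hδ0, hδ1, fun t r ht hr => ?_⟩
  rcases Nat.eq_zero_or_pos t with rfl | htpos
  · exact le_max_of_le_left ((invProb_le_one _ _ _).trans (by simp))
  have hβ : 0 < 1 - α := by linarith
  set θ : ℝ := (((n : ℝ) + 1) ^ k)⁻¹ with hθ
  have hθ0 : 0 ≤ θ := by positivity
  have hθ1 : θ ≤ 1 := inv_le_one_of_one_le₀ (one_le_pow₀ (by linarith [Nat.cast_nonneg (α := ℝ) n]))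
  have hcoins : G.coins.eval n = (n + 1) ^ (k + 1) * L.eval n := by
    simp [hG, inverterPPT]
  have hLn : L.eval n = p.eval n * e + p.eval n + p.eval n +
      G'.coins.eval (n + (p.eval n * e + p.eval n)) := by
    simp [hL, Polynomial.eval_comp]
  have hte : t * e ≤ p.eval n * e := Nat.mul_le_mul_right e ht
  have hq : G'.coins.eval (n + (t * e + r)) ≤ G'.coins.eval (n + (p.eval n * e + p.eval n)) :=
    Polynomial.eval_le_eval_of_le _ (by omega)
  have hl : t * e + r + G'.coins.eval (n + (t * e + r)) ≤ L.eval n := by omega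
  have hLK : L.eval n ≤ G.coins.eval n := by
    rw [hcoins]
    exact Nat.le_mul_of_pos_left _ (by positivity)
  have hbad := one_sub_invProb_le (m := m) (G' := G') (G := G) (M := (n + 1) ^ (k + 1)) hF hR.1
    (fun _ _ => rfl) (t := t) (r := r) hθ1 (hcoins ▸ Nat.mul_le_mul_left _ hl) (hl.trans hLK)
    ((by omega : t ≤ L.eval n).trans hLK)
  have hwalk := invProb_walkPermPrefix_le (m := m) hF hR.1 (hR.2.2 m) h0 hα.le G' t r hθ0
  rw [← hn_def] at hbad hwalk
  set μ : ℝ := (hardVertices F R e n t r G' θ).card / 2 ^ n with hμ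
  have hμ1 : μ ≤ 1 := by
    rw [hμ, div_le_one (by positivity)]
    have hsub : hardVertices F R e n t r G' θ ⊆ strings n := Finset.filter_subset _ _
    have := Finset.card_le_card hsub
    rw [card_strings] at this
    exact_mod_cast this
  have hMexp : (1 - θ) ^ ((n + 1) ^ (k + 1)) ≤ δ n / 4 := by
    refine (one_sub_pow_le_exp hθ1 _).trans ?_
    have h6 : θ * ((n + 1) ^ (k + 1) : ℕ) = (n : ℝ) + 1 := by
      rw [hθ]; push_cast; rw [pow_succ _ k, inv_mul_cancel_left₀ (by positivity)]
    rw [h6]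
    have h7 : 0 < ((n : ℝ) + 1) ^ a := by positivity
    by_contra h
    push Not at h
    have := mul_lt_mul_of_pos_left h h7
    linarith
  have hμδ : δ n * (3 / 4) ≤ μ := by linarith
  have hs : t * θ ≤ ε n * ((1 - α) * δ n) / 8 := by
    have ht' : (t : ℝ) ≤ C * ((n : ℝ) + 1) ^ d := by exact_mod_cast ht.trans (hp n)
    have h6 : (C : ℝ) * 8 ≤ ((n : ℝ) + 1) * (1 - α) := (div_le_iff₀ hβ).1 h4
    rw [hθ, ← div_eq_mul_inv, div_le_iff₀ (by positivity), hk]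
    calc (t : ℝ) ≤ C * ((n : ℝ) + 1) ^ d := ht'
      _ ≤ C * ((n : ℝ) + 1) ^ d * ((((n : ℝ) + 1) ^ a * δ n) * (((n : ℝ) + 1) ^ b * ε n)) :=
          le_mul_of_one_le_right (by positivity) (one_le_mul_of_one_le_of_one_le h2 h3)
      _ = (C * 8) * (((n : ℝ) + 1) ^ d * ((((n : ℝ) + 1) ^ a * δ n) *
            (((n : ℝ) + 1) ^ b * ε n))) / 8 := by ring
      _ ≤ (((n : ℝ) + 1) * (1 - α)) * (((n : ℝ) + 1) ^ d * ((((n : ℝ) + 1) ^ a * δ n) *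
            (((n : ℝ) + 1) ^ b * ε n))) / 8 := by gcongr
      _ = _ := by ring
  refine hwalk.trans (le_trans ?_ (pow_add_le_max (x := (1 - α) * δ n) (by positivity)
    (mul_le_one₀ (by linarith) hδ0.le hδ1) hε0 htpos.ne' hs))
  refine add_le_add_left (pow_le_pow_left₀ ?_ ?_ t) _
  · nlinarith
  · nlinarith

theorem walkPermPrefix_of_length {n t : ℕ} {w : List Bool} (hw : w.length = n + t * e) :
    walkPermPrefix F R e n t w = walkPerm F R e n t w := by
  rw [walkPermPrefix, List.take_of_length_le hw.le, List.drop_of_length_le hw.le, List.append_nil]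

theorem invProb_walkPerm (n t : ℕ) (G' : PPT) : invProb (walkPerm F R e n t) (n + t * e) G' =
    invProb (walkPermPrefix F R e n t) (n + (t * e + 0)) G' :=
  invProb_congr (fun _ hx => (walkPermPrefix_of_length hx).symm) G'

/-- Take `ε = n ^ (-k)`. As `δ ≥ 1/2`, the power is at most `exp (-(1 - α) t / 4)`, which is at most
`n ^ (-k)` once `log n ≤ (1 - α) t / (4k)`. -/
theorem eventually_invProb_walkPermPrefix_le_rpow (hc : 0 < c) (hα : α < 1)
    (hR : IsFullyExplicitExpander c e α R) (hFp : PolyTime F) (hF : IsStringPermutation F)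
    {δ : ℕ → ℝ} (hδ : Significant δ)
    (hinv : ∀ G : PPT, ∀ᶠ n : ℕ in atTop, invProb F n G ≤ 1 - δ n) {t : ℕ → ℕ}
    (ht : ∃ p : Polynomial ℕ, ∀ n : ℕ, t n ≤ p.eval n) (hδ2 : ∀ᶠ n : ℕ in atTop, 1 / 2 ≤ δ n)
    (hlog : Asymptotics.IsLittleO atTop (fun n : ℕ => Real.log n) (fun n : ℕ => (t n : ℝ)))
    (p : Polynomial ℕ) (G' : PPT) {k : ℝ} (hk : 0 < k) :
    ∀ᶠ m : ℕ in atTop, ∀ r : ℕ, r ≤ p.eval (c * m) →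
      invProb (walkPermPrefix F R e (c * m) (t (c * m))) (c * m + (t (c * m) * e + r)) G' ≤
        ((c * m : ℕ) : ℝ) ^ (-k) := by
  obtain ⟨p', hp'⟩ := ht
  have h0 := hR.nonneg hc
  have hβ : 0 < 1 - α := by linarith
  have hε : Significant fun n => (n : ℝ) ^ (-k) := ⟨k, hk, Eventually.of_forall fun n => le_rfl⟩
  have hn : ∀ᶠ n : ℕ in atTop, 1 / 2 ≤ δ n ∧ 1 ≤ n ∧
      Real.log n ≤ (1 - α) / (4 * k) * t n := by
    filter_upwards [hδ2, eventually_ge_atTop 1,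
      hlog.bound (show 0 < (1 - α) / (4 * k) by positivity)] with n h1 h2 h3
    rw [Real.norm_of_nonneg (Nat.cast_nonneg _)] at h3
    exact ⟨h1, h2, (Real.le_norm_self _).trans h3⟩
  filter_upwards [eventually_invProb_walkPermPrefix_le hc hα hR hFp hF hδ hinv (p' + p) G' hε,
    (tendsto_const_mul_nat hc).eventually hn] with m hm hm'
  obtain ⟨h1, h2, h3⟩ := hm'
  obtain ⟨hδ0, hδ1, hm⟩ := hm
  intro r hr
  refine (hm (t (c * m)) r ?_ ?_).trans (max_le ?_ le_rfl)
  · rw [Polynomial.eval_add]; exact (hp' _).trans (Nat.le_add_right _ _)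
  · rw [Polynomial.eval_add]; exact hr.trans (Nat.le_add_left _ _)
  · have hn0 : (0 : ℝ) < (c * m : ℕ) := by exact_mod_cast h2
    have hle : (1 - α) * δ (c * m) ≤ 1 := mul_le_one₀ (by linarith) hδ0.le hδ1
    refine (one_sub_pow_le_exp (by linarith) _).trans ?_
    rw [Real.rpow_def_of_pos hn0, Real.exp_le_exp]
    have h4 : Real.log (c * m : ℕ) * k ≤ (1 - α) / 4 * t (c * m) := by
      calc _ ≤ (1 - α) / (4 * k) * t (c * m) * k := by gcongr
        _ = _ := by field_simp
    have h5 : (1 - α) / 4 * t (c * m) ≤ (1 - α) * δ (c * m) / 2 * t (c * m) := by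
      refine mul_le_mul_of_nonneg_right ?_ (Nat.cast_nonneg _)
      nlinarith
    linarith

theorem walkPermExt_eq_walkPermPrefix {t : ℕ → ℕ} {N m : ℕ}
    (hm : m = Nat.findGreatest (fun i => walkLength c e t i ≤ N) N)
    (hle : walkLength c e t m ≤ N) {w : List Bool} (hw : w.length = N) :
    walkPermExt F R c e t w = walkPermPrefix F R e (c * m) (t (c * m)) w := by
  subst hw
  simp only [walkPermExt]
  rw [← hm, if_pos hle]
  rfl

/-- On length `N` the extension is a walk permutation with a tail of unchanged bits. By the choice
of the largest `m`, `N` is polynomially bounded in `n = c * m`, say `N ≤ n ^ (d + 1)`, so the bound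
`n ^ (-(d + 1) k)` is at most `N ^ (-k)`. -/
theorem negligible_invProb_walkPermExt (hc : 0 < c) {t : ℕ → ℕ}
    (ht : ∃ p : Polynomial ℕ, ∀ n : ℕ, t n ≤ p.eval n) {G' : PPT}
    (h : ∀ (p : Polynomial ℕ) (k : ℝ), 0 < k → ∀ᶠ m : ℕ in atTop, ∀ r : ℕ, r ≤ p.eval (c * m) →
      invProb (walkPermPrefix F R e (c * m) (t (c * m))) (c * m + (t (c * m) * e + r)) G' ≤
        ((c * m : ℕ) : ℝ) ^ (-k)) :
    Negligible (fun N : ℕ => invProb (walkPermExt F R c e t) N G') := by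
  intro k hk
  obtain ⟨p, hp⟩ := ht
  set Q : Polynomial ℕ := Polynomial.X + (c : Polynomial ℕ) +
    p.comp (Polynomial.X + (c : Polynomial ℕ)) * (e : Polynomial ℕ) with hQ
  obtain ⟨C, d, hC⟩ := Q.exists_eval_le_pow
  have hn : ∀ᶠ n : ℕ in atTop, C * 2 ^ d ≤ n ∧ 1 ≤ n :=
    (eventually_ge_atTop _).and (eventually_ge_atTop 1)
  obtain ⟨m₀, hm₀⟩ := eventually_atTop.1 ((h Q ((d + 1 : ℕ) * k) (by positivity)).and
    ((tendsto_const_mul_nat hc).eventually hn))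
  filter_upwards [eventually_ge_atTop (m₀ + walkLength c e t m₀ + 1)] with N hN
  set m := Nat.findGreatest (fun i => walkLength c e t i ≤ N) N with hm
  have hmm₀ : m₀ ≤ m := Nat.le_findGreatest (by omega) (by omega)
  have hle : walkLength c e t m ≤ N :=
    Nat.findGreatest_spec (P := fun i => walkLength c e t i ≤ N) (m := m₀) (by omega) (by omega)
  have hNQ : N ≤ Q.eval (c * m) := by
    have hQe : Q.eval (c * m) = c * m + c + p.eval (c * m + c) * e := by
      simp [hQ, Polynomial.eval_comp]
    rw [hQe]
    -- Either `m + 1` is too large, which bounds `N` by the next walk length, or the search stopped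
    -- at its limit `m = N`, and then `N ≤ c * m`.
    rcases (Nat.findGreatest_le N : m ≤ N).lt_or_eq with hlt | heq
    · have h1 : ¬ walkLength c e t (m + 1) ≤ N :=
        Nat.findGreatest_is_greatest (P := fun i => walkLength c e t i ≤ N) (Nat.lt_succ_self m) hlt
      have h2 := Nat.mul_le_mul_right e (hp (c * (m + 1)))
      simp only [walkLength, mul_add, mul_one] at h1 h2
      omega
    · have := Nat.le_mul_of_pos_left m hc
      omega
  obtain ⟨hb, hCn, hn1⟩ := hm₀ m hmm₀
  have hb' := hb (N - walkLength c e t m) (by omega)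
  have hlen : c * m + (t (c * m) * e + (N - walkLength c e t m)) = N := by
    rw [walkLength] at hle ⊢
    omega
  rw [hlen] at hb'
  rw [invProb_congr (fun w hw => walkPermExt_eq_walkPermPrefix hm hle hw)]
  refine hb'.trans ?_
  have hNn : N ≤ (c * m) ^ (d + 1) := by
    calc N ≤ C * (c * m + 1) ^ d := hNQ.trans (hC _)
      _ ≤ C * (2 * (c * m)) ^ d := by gcongr; omega
      _ = C * 2 ^ d * (c * m) ^ d := by rw [mul_pow]; ring
      _ ≤ (c * m) * (c * m) ^ d := Nat.mul_le_mul_right _ hCn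
      _ = _ := by ring
  have hN0 : (0 : ℝ) < N := by
    have : 0 < N := by omega
    exact_mod_cast this
  have hNn' : (N : ℝ) ≤ ((c * m : ℕ) : ℝ) ^ (d + 1) := by exact_mod_cast hNn
  have heq : ((c * m : ℕ) : ℝ) ^ (-(((d + 1 : ℕ) : ℝ) * k)) =
      (((c * m : ℕ) : ℝ) ^ (d + 1)) ^ (-k) := by
    rw [← Real.rpow_natCast, ← Real.rpow_mul (Nat.cast_nonneg _)]
    congr 1
    ring
  rw [heq]
  exact Real.rpow_le_rpow_of_nonpos hN0 hNn' (by linarith)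

end Main

theorem mainTheorem6
    (c e : ℕ) (hc : 0 < c) (α : ℝ) (hα : α < 1)
    (R : List Bool → List Bool → List Bool × List Bool) (hR : IsFullyExplicitExpander c e α R)
    (F : List Bool → List Bool) (hF : IsWeaklyOneWayPermutation F)
    (t : ℕ → ℕ) (ht : ∃ p : Polynomial ℕ, ∀ n : ℕ, t n ≤ p.eval n)
    (δ : ℕ → ℝ) (hδ : Significant δ)
    (hinv : ∀ G : PPT, ∀ᶠ n : ℕ in Filter.atTop, invProb F n G ≤ 1 - δ n)
    (β : ℝ) (hβ : β = 1 - α) :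
    (∀ G' : PPT, ∀ ε : ℕ → ℝ, Significant ε → ∀ᶠ m : ℕ in Filter.atTop,
      invProb (walkPerm F R e (c * m) (t (c * m))) (walkLength c e t m) G' ≤
        max ((1 - β * δ (c * m) / 2) ^ t (c * m)) (ε (c * m))) ∧
    ((∀ᶠ n : ℕ in Filter.atTop, 7 / β ≤ (t n : ℝ)) →
      ∀ G' : PPT, ∀ᶠ m : ℕ in Filter.atTop,
        invProb (walkPerm F R e (c * m) (t (c * m))) (walkLength c e t m) G' ≤
          max (1 - 2 * δ (c * m)) (1 / 2)) ∧
    ((∀ᶠ n : ℕ in Filter.atTop, 1 / 2 ≤ δ n) →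
      Asymptotics.IsLittleO Filter.atTop (fun n : ℕ => Real.log (n : ℝ)) (fun n : ℕ => (t n : ℝ)) →
      ∀ G' : PPT,
        Negligible (fun m : ℕ =>
          invProb (walkPerm F R e (c * m) (t (c * m))) (walkLength c e t m) G') ∧
        Negligible (fun n : ℕ => invProb (walkPermExt F R c e t) n G')) := by
  obtain ⟨hFp, hFs, -⟩ := hF
  subst hβ
  have h0 := hR.nonneg hc
  have hβ : 0 < 1 - α := by linarith
  have hmain : ∀ G' : PPT, ∀ ε : ℕ → ℝ, Significant ε → ∀ᶠ m : ℕ in Filter.atTop,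
      0 < δ (c * m) ∧ δ (c * m) ≤ 1 ∧
      invProb (walkPerm F R e (c * m) (t (c * m))) (walkLength c e t m) G' ≤
        max ((1 - (1 - α) * δ (c * m) / 2) ^ t (c * m)) (ε (c * m)) := by
    intro G' ε hε
    obtain ⟨p, hp⟩ := ht
    filter_upwards [eventually_invProb_walkPermPrefix_le hc hα hR hFp hFs hδ hinv p G' hε] with m hm
    refine ⟨hm.1, hm.2.1, ?_⟩
    rw [walkLength, invProb_walkPerm]
    exact hm.2.2 _ 0 (hp _) (Nat.zero_le _)
  refine ⟨fun G' ε hε => (hmain G' ε hε).mono fun m hm => hm.2.2, fun ht7 G' => ?_,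
    fun hδ2 hlog G' => ?_⟩
  -- The general bound with `ε = 1/2`; since `(1 - α) t ≥ 7`, its power is at most `exp (-(7/2) δ)`.
  · have hε : Significant fun _ => (1 / 2 : ℝ) := by
      refine ⟨1, one_pos, ?_⟩
      filter_upwards [Filter.eventually_ge_atTop 2] with n hn
      have hn' : (2 : ℝ) ≤ n := by exact_mod_cast hn
      rw [Real.rpow_neg_one, one_div]
      exact inv_anti₀ two_pos hn'
    filter_upwards [hmain G' _ hε, (tendsto_const_mul_nat hc).eventually ht7] with m hm ht7
    obtain ⟨hδ0, hδ1, hm⟩ := hm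
    refine hm.trans (max_le ?_ (le_max_right _ _))
    have hle : (1 - α) * δ (c * m) ≤ 1 := mul_le_one₀ (by linarith) hδ0.le hδ1
    refine (one_sub_pow_le_exp (by linarith) _).trans
      (le_trans (Real.exp_le_exp.2 ?_) (exp_neg_le_max hδ0.le))
    rw [div_le_iff₀ hβ] at ht7
    nlinarith
  · have hrpow := fun (p : Polynomial ℕ) (k : ℝ) (hk : 0 < k) =>
      eventually_invProb_walkPermPrefix_le_rpow hc hα hR hFp hFs hδ hinv ht hδ2 hlog p G' hk
    refine ⟨fun k hk => ?_, negligible_invProb_walkPermExt hc ht hrpow⟩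
    filter_upwards [hrpow 0 k hk, Filter.eventually_ge_atTop 1] with m hm hm1
    rw [walkLength, invProb_walkPerm]
    refine (hm 0 (Nat.zero_le _)).trans ?_
    -- Negligibility is measured in `m`, and `m ≤ c * m`.
    refine Real.rpow_le_rpow_of_nonpos (by exact_mod_cast hm1) ?_ (by linarith)
    exact_mod_cast Nat.le_mul_of_pos_left m hc
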